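/- **Theorem.** For all real numbers $\kappa\ge 2$ and $\xi\in(0,1)$ with $\kappa(1-\xi)>1$ there is a constant $c_{\kappa,\xi}>0$, depending only on $\kappa$ and $\xi$, such that the following holds. *Setting.* Let $\mathcal X$, $\mathcal Q$ be sets, $\mathcal Y$ a measurable space and $(\Theta,\mathfrak b)$ a pseudo-metric space. Let $\mathfrak c\colon\mathcal Y\times\mathcal Q\to\mathbb R$ (cost, with $\mathfrak c(\cdot,q)$ measurable for every $q$), $\mathfrak l\colon\mathcal Q\times\mathcal Q\to\mathbb R$ (loss) and $g\colon\mathcal X\times\Theta\to\mathcal Q$ (link) be functions. For each $t\in\mathcal X$ let $Y_t$ be a $\mathcal Y$-valued random variable with $\mathbb E|\mathfrak c(Y_t,q)|<\infty$ for all $q\in\mathcal Q$, and let $m_t\in\operatorname{arg\,min}_{q\in\mathcal Q}\mathbb E[\mathfrak c(Y_t,q)]$. Assume that there is $\theta^*\in\Theta$ with $g(t,\theta^*)=m_t$ for all $t\in\mathcal X$. Let $n\ge1$, let $x_1,\dots,x_n\in\mathcal X$ be deterministic, and let $y_1,\dots,y_n$ be independent $\mathcal Y$-valued random variables such that $y_i$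 has the same distribution as $Y_{x_i}$. Let (almost surely) $$\hat\theta\in\operatorname*{arg\,min}_{\theta\in\Theta}\frac1n\sum_{i=1}^n\mathfrak c(y_i,g(x_i,\theta)),\qquad \hat m_t=g(t,\hat\theta),$$ where $\frac1n\sum_{i}\mathfrak l(m_{x_i},\hat m_{x_i})$ is measurable. *Notation.* For $\theta_0\in\Theta$ and $\delta\ge 0$ let $\mathcal B_{\mathbf x}(\theta_0,\mathfrak l,\delta)=\{\theta\in\Theta:\frac1n\sum_{i=1}^n\mathfrak l(g(x_i,\theta_0),g(x_i,\theta))\le\delta\}$. For $t\in\mathcal X$ and $y,z\in\mathcal Y$ let $$\mathfrak a_t(y,z)=\sup_{\theta\neq\tilde\theta}\frac{\mathfrak c(y,g(t,\theta))-\mathfrak c(z,g(t,\theta))-\mathfrak c(y,g(t,\tilde\theta))+\mathfrak c(z,g(t,\tilde\theta))}{\mathfrak b(\theta,\tilde\theta)}\in[0,\infty],$$ where a quotient with $\mathfrak b(\theta,\tilde\theta)=0$ is $0$ if its numerator is $0$ and has absolute value $\infty$ with the sign of the numerator otherwise, and the supremum over the empty set is $0$. For a pseudo-metric space $(B,\mathfrak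 b)$ let $$\gamma_2(B,\mathfrak b)=\inf_{(\mathcal A_k)}\ \sup_{q\in B}\ \sum_{k=0}^\infty 2^{k/2}\operatorname{diam}(A_k(q),\mathfrak b)\in[0,\infty],$$ where the infimum is over all sequences $(\mathcal A_k)_{k\ge0}$ of partitions of $B$ such that $\mathcal A_0$ is the trivial partition, $\mathcal A_{k+1}$ refines $\mathcal A_k$, and $\mathcal A_k$ has at most $2^{2^k}$ parts for $k\ge1$; $A_k(q)$ denotes the part of $\mathcal A_k$ that contains $q$. *Assumptions.* - Variance: $C_{\mathsf{Vlo}}\ge1$ and $C_{\mathsf{Vlo}}^{-1}\,\mathfrak l(m_t,q)\le\mathbb E[\mathfrak c(Y_t,q)-\mathfrak c(Y_t,m_t)]$ for all $t\in\mathcal X$, $q\in\mathcal Q$. - Entropy: $T_n\ge0$, $C_{\mathsf{Ent}}\ge1$ and $\gamma_2(\mathcal B_{\mathbf x}(\theta_0,\mathfrak l,\delta),\mathfrak b)\le C_{\mathsf{Ent}}\,\delta^\xi$ for all $\delta\ge T_n$ and $\theta_0\in\Theta$. - Moment: $C_{\mathsf{Mom}}\ge1$, and there are reference points $z_t\in\mathcal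 Y$, $t\in\mathcal X$ (for example $z_t=m_t$ when $\mathcal Q\subseteq\mathcal Y$), such that $\mathfrak a_t(\cdot,z_t)$ is measurable with respect to the completed law of $Y_t$ and $\mathbb E[\mathfrak a_t(Y_t,z_t)^\kappa]^{1/\kappa}\le C_{\mathsf{Mom}}$ for all $t\in\mathcal X$. *Conclusion.* $$\mathbb E\Big[\frac1n\sum_{i=1}^n\mathfrak l(m_{x_i},\hat m_{x_i})\Big]\le C\,n^{-\frac1{2(1-\xi)}}+C_{\mathsf{Vlo}}T_n,\qquad C=c_{\kappa,\xi}\,\big(C_{\mathsf{Vlo}}\,C_{\mathsf{Ent}}\,C_{\mathsf{Mom}}\big)^{\frac1{1-\xi}},$$ and the same bound holds for the expectation of the positive part of $\frac1n\sum_{i}\mathfrak l(m_{x_i},\hat m_{x_i})$. -/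

import Mathlib

open MeasureTheory ProbabilityTheory
open scoped ENNReal

noncomputable section

/-- An admissible sequence of partitions of `E`. A partition is given by its equivalence relation
(two points are related iff they lie in the same part): the first partition is trivial, each
partition refines the previous one, and the `k`-th one has at most `2 ^ (2 ^ k)` parts for
`k ≥ 1`. -/
structure AdmissibleSequence (E : Type*) where
  part : ℕ → Setoid E
  part_zero : part 0 = ⊤
  refines : ∀ k, part (k + 1) ≤ part k
  card_le : ∀ k, 1 ≤ k → ENat.card (Quotient (part k)) ≤ 2 ^ (2 ^ k)

/-- The part of the `k`-th partition that contains `q`. -/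
def AdmissibleSequence.cell {E : Type*} (A : AdmissibleSequence E) (k : ℕ) (q : E) : Set E :=
  {p | A.part k p q}

/-- Talagrand's `γ₂` of a pseudo-metric space: the infimum over all admissible sequences of
`sup_q ∑_k 2^{k/2} diam (A_k(q))`, with values in `[0, ∞]`. -/
def gammaTwo (E : Type*) [PseudoEMetricSpace E] : ℝ≥0∞ :=
  ⨅ A : AdmissibleSequence E, ⨆ q : E,
    ∑' k : ℕ, ENNReal.ofReal ((2 : ℝ) ^ ((k : ℝ) / 2)) * Metric.ediam (A.cell k q)

/-- The empirical cost `(1/n) ∑ c(y_i, g(x_i, θ))` of a parameter. -/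
def empiricalCost {X Y Q Θ : Type*} (c : Y → Q → ℝ) (g : X → Θ → Q) {n : ℕ}
    (x : Fin n → X) (y : Fin n → Y) (θ : Θ) : ℝ :=
  (1 / (n : ℝ)) * ∑ i, c (y i) (g (x i) θ)

/-- The averaged loss `(1/n) ∑ l(g(x_i, θ₀), g(x_i, θ))` of `θ` relative to `θ₀`. -/
def averageLoss {X Q Θ : Type*} (l : Q → Q → ℝ) (g : X → Θ → Q) {n : ℕ}
    (x : Fin n → X) (θ₀ θ : Θ) : ℝ :=
  (1 / (n : ℝ)) * ∑ i, l (g (x i) θ₀) (g (x i) θ)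

/-- The ball of radius `δ` around `θ₀` with respect to the averaged loss. -/
def lossBall {X Q Θ : Type*} (l : Q → Q → ℝ) (g : X → Θ → Q) {n : ℕ}
    (x : Fin n → X) (θ₀ : Θ) (δ : ℝ) : Set Θ :=
  {θ | averageLoss l g x θ₀ θ ≤ δ}

/-- The quadruple `c_t(y, θ) - c_t(z, θ) - c_t(y, θ') + c_t(z, θ')` with
`c_t(y, θ) = c(y, g(t, θ))`. -/
def quadruple {X Y Q Θ : Type*} (c : Y → Q → ℝ) (g : X → Θ → Q) (t : X) (y z : Y)
    (θ θ' : Θ) : ℝ :=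
  c y (g t θ) - c z (g t θ) - c y (g t θ') + c z (g t θ')

/-- The quadruple constant `a_t(y, z)`, the supremum over `θ ≠ θ'` of the quadruple divided by
the distance of `θ` and `θ'`, with values in `[0, ∞]`. The quadruple changes its sign when `θ` and
`θ'` are exchanged, so that taking positive parts does not change the supremum. If the
distance vanishes, the quotient is `∞` for a positive quadruple, and `0` for a quadruple
that is zero. -/
def quadConst {X Y Q Θ : Type*} [PseudoMetricSpace Θ] (c : Y → Q → ℝ) (g : X → Θ → Q) (t : X)
    (y z : Y) : ℝ≥0∞ :=
  ⨆ (θ : Θ) (θ' : Θ) (_ : θ ≠ θ'),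
    ENNReal.ofReal (quadruple c g t y z θ θ') / ENNReal.ofReal (dist θ θ')

end

/-!
The proof compares the variance inequality with the minimality of `θhat`: together they bound
the averaged loss of `θhat`, up to the factor `CVlo`, by the increment from `θstar` to `θhat` of the
centered empirical process `centeredSum`. If the averaged loss lies in a shell `[δ, 2δ)`, the
process attains a value of size `n δ / CVlo` on the loss ball of radius `2δ` around `θstar`, and
Markov's inequality for the `κ`-th moment of its supremum bounds the probability of that event.

The moment bound (`lintegral_iSup_centeredSum_rpow_le`) comes from symmetrization and generic
chaining. An independent copy of the sample is introduced by Jensen's inequality, and exchanging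
observations with their copies inserts random signs. Conditionally on both samples this is a
Rademacher process, whose increments are subgaussian: the quadruple constants `a i` make its
coefficients Lipschitz with constant `(∑ (a i + a' i)²)^{1/2}`. Chaining along an admissible
sequence (`AdmissibleSequence.sum_iSup_signSum_rpow_le`) controls all links of all chains by a
single random variable with finite `κ`-th moment, so that the supremum has `κ`-th moment of order
`γ₂ ^ κ` times the `κ`-th power of this Lipschitz constant, whose moment is of order `n ^ (κ / 2)`
because `κ ≥ 2`.

Hence the shell `[δ, 2δ)` has probability at most a constant times `(r / δ) ^ (κ (1 - ξ))`, where `r`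
is the asserted rate. Summing `2δ` times this bound over `δ = 2 ^ j max(r, T)` gives a geometric
series since `κ (1 - ξ) > 1` (`lintegral_ofReal_le_of_dyadic_tail`).

Neither the ball nor the choice of `θhat` needs to be measurable: finiteness of `γ₂` yields a
countable dense subset of the ball, and the process is continuous almost surely.
-/

/-! ### Rademacher sums -/

/-- The signed sum `∑ ± b i`, where the sign of `b i` is `+` iff `ε i` is true. Averaging over all
`ε : ι → Bool` is taking the expectation over independent Rademacher signs. -/
noncomputable def signSum {ι : Type*} [Fintype ι] (b : ι → ℝ) (ε : ι → Bool) : ℝ :=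
  ∑ i, if ε i then b i else -b i

section Rademacher

variable {ι : Type*} [Fintype ι]

lemma signSum_sub (b b' : ι → ℝ) (ε : ι → Bool) :
    signSum (fun i => b i - b' i) ε = signSum b ε - signSum b' ε := by
  unfold signSum
  rw [← Finset.sum_sub_distrib]
  refine Finset.sum_congr rfl fun i _ => ?_
  split_ifs <;> ring

lemma signSum_const_mul (r : ℝ) (b : ι → ℝ) (ε : ι → Bool) :
    signSum (fun i => r * b i) ε = r * signSum b ε := by
  unfold signSum
  rw [Finset.mul_sum]
  refine Finset.sum_congr rfl fun i _ => ?_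
  split_ifs <;> ring

lemma abs_signSum_le (b : ι → ℝ) (ε : ι → Bool) : |signSum b ε| ≤ ∑ i, |b i| := by
  refine (Finset.abs_sum_le_sum_abs _ _).trans (Finset.sum_le_sum fun i _ => ?_)
  split_ifs <;> simp

lemma sum_exp_signSum_le [DecidableEq ι] (b : ι → ℝ) :
    ∑ ε : ι → Bool, Real.exp (signSum b ε)
      ≤ 2 ^ Fintype.card ι * Real.exp ((∑ i, b i ^ 2) / 2) := by
  have h1 : ∑ ε : ι → Bool, Real.exp (signSum b ε) = ∏ i, (2 * Real.cosh (b i)) := by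
    have h := Finset.prod_univ_sum (fun _ : ι => (Finset.univ : Finset Bool))
      (fun i e => Real.exp (if e then b i else -b i))
    rw [Fintype.piFinset_univ] at h
    simp only [signSum, Real.exp_sum]
    rw [← h]
    refine Finset.prod_congr rfl fun i _ => ?_
    rw [Real.cosh_eq]
    simp
    ring
  rw [h1, Finset.prod_mul_distrib, Finset.prod_const, Finset.card_univ, Finset.sum_div,
    Real.exp_sum]
  gcongr with i
  exact Real.cosh_le_exp_half_sq _

lemma sum_exp_abs_signSum_le [DecidableEq ι] (b : ι → ℝ) :
    ∑ ε : ι → Bool, Real.exp |signSum b ε|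
      ≤ 2 * 2 ^ Fintype.card ι * Real.exp ((∑ i, b i ^ 2) / 2) := by
  have hneg : ∀ ε, signSum (fun i => -b i) ε = -signSum b ε := fun ε => by
    simpa using signSum_const_mul (-1) b ε
  have h1 := sum_exp_signSum_le b
  have h2 := sum_exp_signSum_le (fun i => -b i)
  simp only [hneg, neg_sq] at h2
  have h3 : ∑ ε : ι → Bool, Real.exp |signSum b ε|
      ≤ ∑ ε : ι → Bool, (Real.exp (signSum b ε) + Real.exp (-signSum b ε)) := by
    refine Finset.sum_le_sum fun ε _ => ?_
    rcases abs_cases (signSum b ε) with ⟨h, _⟩ | ⟨h, _⟩ <;> rw [h] <;>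
      nlinarith [Real.exp_pos (signSum b ε), Real.exp_pos (-signSum b ε)]
  rw [Finset.sum_add_distrib] at h3
  linarith

lemma rpow_le_rpow_self_mul_exp {κ x : ℝ} (hκ : 0 < κ) (hx : 0 ≤ x) :
    x ^ κ ≤ κ ^ κ * Real.exp x := by
  have h : x / κ ≤ Real.exp (x / κ) := by linarith [Real.add_one_le_exp (x / κ)]
  have h2 : (x / κ) ^ κ ≤ Real.exp (x / κ) ^ κ := by gcongr
  rw [Real.div_rpow hx hκ.le, ← Real.exp_mul, div_mul_cancel₀ _ hκ.ne',
    div_le_iff₀ (by positivity)] at h2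
  linarith

lemma two_rpow_half_sq (k : ℕ) : ((2 : ℝ) ^ ((k : ℝ) / 2)) ^ 2 = 2 ^ k := by
  rw [← Real.rpow_natCast, ← Real.rpow_mul (by norm_num), ← Real.rpow_natCast]
  congr 1
  push_cast
  ring

/-- The constant of the `κ`-th moment bound for the maximum of Rademacher sums. -/
noncomputable def chainConst (κ : ℝ) : ℝ := 5 ^ κ + 2 * κ ^ κ

lemma chainConst_pos {κ : ℝ} (hκ : 0 < κ) : 0 < chainConst κ := by
  unfold chainConst
  positivity

/-- The tail of one normalized Rademacher sum, summed over the signs: at level `k` it is so small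
that it can be paid for by `2 ^ (2 ^ (k + 1))` sums. -/
lemma sum_exp_level_le [DecidableEq ι] {κ : ℝ} (hκ : 0 < κ) (k : ℕ) (v : ι → ℝ)
    (hv : ∑ i, v i ^ 2 ≤ 1) :
    ∑ ε : ι → Bool, κ ^ κ *
        Real.exp (2 * (2 : ℝ) ^ ((k : ℝ) / 2) * |signSum v ε| - 5 * 2 ^ k)
      ≤ 2 ^ Fintype.card ι * (2 * κ ^ κ * Real.exp (-3) ^ (2 ^ k)) := by
  set s : ℝ := (2 : ℝ) ^ ((k : ℝ) / 2) with hs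
  have hs0 : 0 < s := by positivity
  have h := sum_exp_abs_signSum_le (fun i => (2 * s) * v i)
  simp only [signSum_const_mul, abs_mul, mul_pow, ← Finset.mul_sum, abs_of_pos hs0, abs_two] at h
  have hs2 : s ^ 2 = 2 ^ k := two_rpow_half_sq k
  rw [hs2] at h
  calc ∑ ε : ι → Bool, κ ^ κ * Real.exp (2 * s * |signSum v ε| - 5 * 2 ^ k)
      = κ ^ κ * Real.exp (-(5 * 2 ^ k)) * ∑ ε : ι → Bool, Real.exp (2 * s * |signSum v ε|) := by
        rw [Finset.mul_sum]
        refine Finset.sum_congr rfl fun ε _ => ?_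
        rw [sub_eq_add_neg, Real.exp_add]
        ring
    _ ≤ κ ^ κ * Real.exp (-(5 * 2 ^ k)) * (2 * 2 ^ Fintype.card ι * Real.exp (2 * 2 ^ k)) := by
        gcongr
        refine h.trans ?_
        gcongr
        nlinarith [pow_pos (two_pos : (0 : ℝ) < 2) k]
    _ = _ := by
        rw [← Real.exp_nat_mul]
        have : Real.exp (((2 ^ k : ℕ) : ℝ) * -3)
            = Real.exp (-(5 * 2 ^ k)) * Real.exp (2 * 2 ^ k) := by
          rw [← Real.exp_add]
          push_cast
          ring_nf
        rw [this]
        ring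

lemma tsum_ofReal_exp_pow_le :
    ∑' k : ℕ, (2 : ℝ≥0∞) ^ (2 ^ (k + 1)) * ENNReal.ofReal (Real.exp (-3)) ^ (2 ^ k) ≤ 1 := by
  have he : ENNReal.ofReal (Real.exp (-3)) ≤ 8⁻¹ := by
    have h3 : (8 : ℝ) ≤ Real.exp 3 := by
      have h1 : (2 : ℝ) ≤ Real.exp 1 := by linarith [Real.add_one_le_exp (1 : ℝ)]
      calc (8 : ℝ) = 2 ^ 3 := by norm_num
        _ ≤ Real.exp 1 ^ 3 := by gcongr
        _ = Real.exp 3 := by rw [← Real.exp_nat_mul]; norm_num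
    rw [Real.exp_neg, ENNReal.ofReal_inv_of_pos (Real.exp_pos _), ENNReal.inv_le_inv]
    calc (8 : ℝ≥0∞) = ENNReal.ofReal 8 := by simp
      _ ≤ _ := ENNReal.ofReal_le_ofReal h3
  have hterm : ∀ k : ℕ, (2 : ℝ≥0∞) ^ (2 ^ (k + 1)) * ENNReal.ofReal (Real.exp (-3)) ^ (2 ^ k)
      ≤ (2 : ℝ≥0∞)⁻¹ ^ (k + 1) := by
    intro k
    calc (2 : ℝ≥0∞) ^ (2 ^ (k + 1)) * ENNReal.ofReal (Real.exp (-3)) ^ (2 ^ k)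
        = (2 ^ 2 * ENNReal.ofReal (Real.exp (-3))) ^ (2 ^ k) := by
          rw [mul_pow, ← pow_mul, pow_succ, mul_comm 2]
      _ ≤ (2⁻¹ : ℝ≥0∞) ^ (2 ^ k) := by
          gcongr
          calc (2 : ℝ≥0∞) ^ 2 * ENNReal.ofReal (Real.exp (-3)) ≤ 2 ^ 2 * 8⁻¹ := by gcongr
            _ = 2⁻¹ := by
              rw [show (8 : ℝ≥0∞) = 2 ^ 2 * 2 by norm_num,
                ENNReal.mul_inv (by simp) (by simp), ← mul_assoc,
                ENNReal.mul_inv_cancel (by simp) (by simp), one_mul]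
      _ ≤ (2 : ℝ≥0∞)⁻¹ ^ (k + 1) :=
          pow_le_pow_right_of_le_one' (by simp) (Nat.lt_two_pow_self)
  calc _ ≤ ∑' k : ℕ, (2 : ℝ≥0∞)⁻¹ ^ (k + 1) := ENNReal.tsum_le_tsum hterm
    _ = 1 := by
      simp_rw [pow_succ']
      rw [ENNReal.tsum_mul_left, ENNReal.tsum_geometric, ENNReal.one_sub_inv_two, inv_inv,
        ENNReal.inv_mul_cancel (by simp) (by simp)]

/-- Maximal inequality: if the `k`-th of countably many families consists of at most
`2 ^ (2 ^ (k + 1))` Rademacher sums of unit variance, then all of these sums are bounded by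
`2 ^ (k / 2) * w`, where `w` is a single random variable whose `κ`-th moment is
at most `chainConst κ`. -/
theorem exists_uniform_signSum_bound [DecidableEq ι] {κ : ℝ} (hκ : 0 < κ) {C : ℕ → Type*}
    (hC : ∀ k, ENat.card (C k) ≤ 2 ^ (2 ^ (k + 1))) (v : ∀ k, C k → ι → ℝ)
    (hv : ∀ k c, ∑ i, v k c i ^ 2 ≤ 1) :
    ∃ w : (ι → Bool) → ℝ≥0∞,
      (∑ ε, w ε ^ κ ≤ 2 ^ Fintype.card ι * ENNReal.ofReal (chainConst κ)) ∧
      ∀ ε k c, ENNReal.ofReal |signSum (v k c) ε|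
        ≤ ENNReal.ofReal ((2 : ℝ) ^ ((k : ℝ) / 2)) * w ε := by
  -- `w ^ κ` is a deterministic truncation level plus the sum of bounds on all exceedances; the
  -- level `5` makes a summand of order `k` at most `exp (-3) ^ (2 ^ k)` on average, less than the
  -- inverse of the number of summands
  let F : (ι → Bool) → ∀ k, C k → ℝ≥0∞ := fun ε k c => ENNReal.ofReal (κ ^ κ *
    Real.exp (2 * (2 : ℝ) ^ ((k : ℝ) / 2) * |signSum (v k c) ε| - 5 * 2 ^ k))
  let M : (ι → Bool) → ℝ≥0∞ := fun ε =>
    ENNReal.ofReal (5 ^ κ) + ∑' k, ∑' c, F ε k c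
  refine ⟨fun ε => M ε ^ κ⁻¹, ?_, fun ε k c => ?_⟩
  · have hF : ∀ k c, ∑ ε, F ε k c ≤ 2 ^ Fintype.card ι *
        (ENNReal.ofReal (2 * κ ^ κ) * ENNReal.ofReal (Real.exp (-3)) ^ (2 ^ k)) := by
      intro k c
      rw [← ENNReal.ofReal_sum_of_nonneg (fun ε _ => by positivity)]
      refine (ENNReal.ofReal_le_ofReal (sum_exp_level_le hκ k (v k c) (hv k c))).trans_eq ?_
      rw [ENNReal.ofReal_mul (by positivity), ENNReal.ofReal_mul (by positivity),
        ENNReal.ofReal_pow (by positivity), ENNReal.ofReal_pow (by positivity)]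
      simp
    have hsum : ∑ ε, ∑' k, ∑' c, F ε k c ≤ 2 ^ Fintype.card ι * ENNReal.ofReal (2 * κ ^ κ) := by
      calc ∑ ε, ∑' k, ∑' c, F ε k c = ∑' k, ∑' c, ∑ ε, F ε k c := by
            simp_rw [← tsum_fintype (L := .unconditional _)]
            rw [ENNReal.tsum_comm]
            refine tsum_congr fun k => ?_
            rw [ENNReal.tsum_comm]
        _ ≤ ∑' k, ∑' _ : C k, 2 ^ Fintype.card ι *
            (ENNReal.ofReal (2 * κ ^ κ) * ENNReal.ofReal (Real.exp (-3)) ^ (2 ^ k)) :=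
            ENNReal.tsum_le_tsum fun k => ENNReal.tsum_le_tsum fun c => hF k c
        _ ≤ ∑' k : ℕ, 2 ^ Fintype.card ι * ENNReal.ofReal (2 * κ ^ κ) *
            (2 ^ (2 ^ (k + 1)) * ENNReal.ofReal (Real.exp (-3)) ^ (2 ^ k)) := by
            refine ENNReal.tsum_le_tsum fun k => ?_
            rw [ENNReal.tsum_const]
            have : (ENat.card (C k) : ℝ≥0∞) ≤ 2 ^ (2 ^ (k + 1)) := by
              have := ENat.toENNReal_le.2 (hC k)
              simpa using this
            calc _ ≤ 2 ^ (2 ^ (k + 1)) * (2 ^ Fintype.card ι *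
                (ENNReal.ofReal (2 * κ ^ κ) * ENNReal.ofReal (Real.exp (-3)) ^ (2 ^ k))) := by
                  gcongr
              _ = _ := by ring
        _ ≤ _ := by
            rw [ENNReal.tsum_mul_left]
            exact mul_le_of_le_one_right' tsum_ofReal_exp_pow_le
    calc ∑ ε, (M ε ^ κ⁻¹) ^ κ = ∑ ε, M ε := by
          simp_rw [ENNReal.rpow_inv_rpow hκ.ne']
      _ = 2 ^ Fintype.card ι * ENNReal.ofReal (5 ^ κ) + ∑ ε, ∑' k, ∑' c, F ε k c := by
          simp [M, Finset.sum_add_distrib]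
      _ ≤ 2 ^ Fintype.card ι * ENNReal.ofReal (5 ^ κ)
            + 2 ^ Fintype.card ι * ENNReal.ofReal (2 * κ ^ κ) := by gcongr
      _ = _ := by
          rw [← mul_add, ← ENNReal.ofReal_add (by positivity) (by positivity)]
          rfl
  · set s : ℝ := (2 : ℝ) ^ ((k : ℝ) / 2) with hs
    have hs1 : 1 ≤ s := Real.one_le_rpow (by norm_num) (by positivity)
    have hs2 : s ^ 2 = 2 ^ k := two_rpow_half_sq k
    set r := |signSum (v k c) ε| with hr
    have hr0 : 0 ≤ r := abs_nonneg _
    have key : ENNReal.ofReal (r / s) ≤ M ε ^ κ⁻¹ := by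
      rw [ENNReal.le_rpow_inv_iff hκ, ENNReal.ofReal_rpow_of_nonneg (by positivity) hκ.le]
      by_cases h5 : r / s ≤ 5
      · refine le_add_right (ENNReal.ofReal_le_ofReal ?_)
        gcongr
      · have h5' : 5 * s < r := by
          rw [not_le, lt_div_iff₀ (by positivity)] at h5
          exact h5
        have hle : r / s ≤ 2 * s * r - 5 * 2 ^ k := by
          have : r / s ≤ r := div_le_self hr0 hs1
          nlinarith
        have hF : ENNReal.ofReal ((r / s) ^ κ) ≤ F ε k c := by
          refine ENNReal.ofReal_le_ofReal
            ((rpow_le_rpow_self_mul_exp hκ (by positivity)).trans ?_)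
          gcongr
        exact hF.trans ((ENNReal.le_tsum c).trans
          ((ENNReal.le_tsum (f := fun k => ∑' c, F ε k c) k).trans le_add_self))
    calc ENNReal.ofReal r = ENNReal.ofReal s * ENNReal.ofReal (r / s) := by
          rw [← ENNReal.ofReal_mul (by positivity)]
          congr 1
          field_simp
      _ ≤ _ := by gcongr

end Rademacher

/-! ### Chaining along an admissible sequence -/

namespace AdmissibleSequence

variable {E : Type*}

/-- A representative of the part of the `k`-th partition that contains `q`. -/
noncomputable def rep (A : AdmissibleSequence E) (k : ℕ) (q : E) : E :=
  (Quotient.mk (A.part k) q).out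

lemma rep_rel (A : AdmissibleSequence E) (k : ℕ) (q : E) : A.part k (A.rep k q) q :=
  Quotient.mk_out (s := A.part k) q

lemma rep_eq_of_rel (A : AdmissibleSequence E) {k : ℕ} {p q : E} (h : A.part k p q) :
    A.rep k p = A.rep k q := by
  unfold rep
  rw [Quotient.sound (s := A.part k) h]

lemma rep_zero (A : AdmissibleSequence E) (p q : E) : A.rep 0 p = A.rep 0 q :=
  A.rep_eq_of_rel (by rw [A.part_zero]; trivial)

lemma edist_rep_le [PseudoEMetricSpace E] (A : AdmissibleSequence E) (k : ℕ) (q : E) :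
    edist (A.rep k q) q ≤ Metric.ediam (A.cell k q) :=
  Metric.edist_le_ediam_of_mem (A.rep_rel k q) ((A.part k).refl q)

lemma edist_rep_succ_le [PseudoEMetricSpace E] (A : AdmissibleSequence E) (k : ℕ) (q : E) :
    edist (A.rep (k + 1) q) (A.rep k q) ≤ Metric.ediam (A.cell k q) :=
  Metric.edist_le_ediam_of_mem (A.refines k (A.rep_rel (k + 1) q)) (A.rep_rel k q)

/-- The chaining sum `∑ 2^{k/2} diam (A_k(q))` of a point. -/
noncomputable def chainSum [PseudoEMetricSpace E] (A : AdmissibleSequence E) (q : E) : ℝ≥0∞ :=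
  ∑' k : ℕ, ENNReal.ofReal ((2 : ℝ) ^ ((k : ℝ) / 2)) * Metric.ediam (A.cell k q)

lemma tendsto_rep [PseudoEMetricSpace E] (A : AdmissibleSequence E) {q : E}
    (h : A.chainSum q ≠ ∞) : Filter.Tendsto (fun k => A.rep k q) Filter.atTop (nhds q) := by
  rw [tendsto_iff_edist_tendsto_0]
  refine tendsto_of_tendsto_of_tendsto_of_le_of_le tendsto_const_nhds
    (ENNReal.tendsto_atTop_zero_of_tsum_ne_top h) (fun _ => zero_le) fun k => ?_
  refine (A.edist_rep_le k q).trans (le_mul_of_one_le_left' ?_)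
  rw [← ENNReal.ofReal_one]
  exact ENNReal.ofReal_le_ofReal (Real.one_le_rpow (by norm_num) (by positivity))

/-- Generic chaining for Rademacher processes: if the coefficients `b` are Lipschitz with constant
`σ` in Euclidean norm, the `κ`-th moment of the supremum of the process is controlled by the
chaining sums of any admissible sequence. -/
theorem sum_iSup_signSum_rpow_le [PseudoMetricSpace E] (A : AdmissibleSequence E)
    {ι : Type*} [Fintype ι] [DecidableEq ι] {κ : ℝ} (hκ : 0 < κ) {Γ : ℝ≥0∞} (hΓ : Γ ≠ ∞)
    (hA : ∀ q, A.chainSum q ≤ Γ) (b : ι → E → ℝ) {σ : ℝ} (hσ : 0 ≤ σ)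
    (hb : ∀ p q, ∑ i, (b i p - b i q) ^ 2 ≤ (σ * dist p q) ^ 2) (q₀ : E) :
    ∑ ε, (⨆ q, ENNReal.ofReal |signSum (fun i => b i q - b i q₀) ε|) ^ κ
      ≤ 2 ^ Fintype.card ι * (ENNReal.ofReal (chainConst κ) * (2 * (ENNReal.ofReal σ * Γ)) ^ κ) := by
  let v : ∀ k, Quotient (A.part (k + 1)) → ι → ℝ := fun k c i =>
    (σ * dist c.out (A.rep k c.out))⁻¹ * (b i c.out - b i (A.rep k c.out))
  have hv : ∀ k c, ∑ i, v k c i ^ 2 ≤ 1 := by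
    intro k c
    simp only [v, mul_pow, ← Finset.mul_sum]
    refine (mul_le_mul_of_nonneg_left (hb _ _) (by positivity)).trans ?_
    rw [← mul_pow]
    rcases eq_or_ne (σ * dist c.out (A.rep k c.out)) 0 with h | h
    · simp [h]
    · rw [inv_mul_cancel₀ h, one_pow]
  obtain ⟨w, hw, hvw⟩ := exists_uniform_signSum_bound hκ
    (fun k => A.card_le (k + 1) (Nat.succ_le_succ (Nat.zero_le k))) v hv
  have hb1 : ∀ i p q, |b i p - b i q| ≤ σ * dist p q := fun i p q =>
    abs_le_of_sq_le_sq ((Finset.single_le_sum (f := fun i => (b i p - b i q) ^ 2)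
      (fun _ _ => sq_nonneg _) (Finset.mem_univ i)).trans (hb p q)) (by positivity)
  -- every link of the chain is controlled by `w`
  have hlink : ∀ ε k q, edist (signSum (fun i => b i (A.rep k q)) ε)
      (signSum (fun i => b i (A.rep (k + 1) q)) ε)
      ≤ (w ε * ENNReal.ofReal σ) *
        (ENNReal.ofReal ((2 : ℝ) ^ ((k : ℝ) / 2)) * Metric.ediam (A.cell k q)) := by
    intro ε k q
    have hrep : A.rep k (A.rep (k + 1) q) = A.rep k q :=
      A.rep_eq_of_rel (A.refines k (A.rep_rel (k + 1) q))
    have hlt := hvw ε k (Quotient.mk _ q)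
    have hveq : v k (Quotient.mk _ q) = fun i => (σ * dist (A.rep (k + 1) q) (A.rep k q))⁻¹ *
        (b i (A.rep (k + 1) q) - b i (A.rep k q)) := by
      funext i
      change (σ * dist (A.rep (k + 1) q) (A.rep k (A.rep (k + 1) q)))⁻¹ *
        (b i (A.rep (k + 1) q) - b i (A.rep k (A.rep (k + 1) q))) = _
      rw [hrep]
    rw [hveq, signSum_const_mul, signSum_sub] at hlt
    set p := A.rep (k + 1) q
    set p' := A.rep k q
    have hdist : ENNReal.ofReal (dist p p') ≤ Metric.ediam (A.cell k q) := by
      rw [← edist_dist]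
      exact A.edist_rep_succ_le k q
    rw [edist_comm, edist_dist, Real.dist_eq]
    set S := signSum (fun i => b i p) ε - signSum (fun i => b i p') ε with hS
    have hSeq : |S| = |(σ * dist p p')⁻¹ * S| * (σ * dist p p') := by
      rcases eq_or_ne (σ * dist p p') 0 with h | h
      · have : S = 0 := by
          rw [hS, ← signSum_sub]
          refine abs_nonpos_iff.1 ((abs_signSum_le _ _).trans
            (Finset.sum_nonpos fun i _ => ?_))
          simpa [h] using hb1 i p p'
        simp [h, this]
      · rw [abs_mul, abs_inv, abs_of_nonneg (by positivity : 0 ≤ σ * dist p p'), mul_right_comm,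
          inv_mul_cancel₀ h, one_mul]
    rw [hSeq, ENNReal.ofReal_mul (abs_nonneg _), ENNReal.ofReal_mul hσ]
    calc _ ≤ (ENNReal.ofReal ((2 : ℝ) ^ ((k : ℝ) / 2)) * w ε) *
          (ENNReal.ofReal σ * Metric.ediam (A.cell k q)) := by gcongr
      _ = _ := by ring
  have hroot : ∀ ε q, edist (signSum (fun i => b i (A.rep 0 q₀)) ε) (signSum (fun i => b i q) ε)
      ≤ w ε * ENNReal.ofReal σ * Γ := by
    intro ε q
    have hlim : Filter.Tendsto (fun k => signSum (fun i => b i (A.rep k q)) ε) Filter.atTop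
        (nhds (signSum (fun i => b i q) ε)) := by
      have hcont : ∀ i, Continuous (b i) := fun i =>
        (LipschitzWith.of_dist_le_mul (K := ⟨σ, hσ⟩) fun p q => by
          rw [Real.dist_eq]
          exact hb1 i p q).continuous
      have htend := A.tendsto_rep (ne_top_of_le_ne_top hΓ (hA q))
      unfold signSum
      refine tendsto_finsetSum _ fun i _ => ?_
      have := ((hcont i).tendsto q).comp htend
      split_ifs
      · exact this
      · exact this.neg
    have h := edist_le_tsum_of_edist_le_of_tendsto₀ _ (fun k => hlink ε k q) hlim
    rw [ENNReal.tsum_mul_left, A.rep_zero q q₀] at h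
    exact h.trans (by gcongr; exact hA q)
  have hsup : ∀ ε, (⨆ q, ENNReal.ofReal |signSum (fun i => b i q - b i q₀) ε|)
      ≤ w ε * (2 * (ENNReal.ofReal σ * Γ)) := by
    intro ε
    refine iSup_le fun q => ?_
    rw [signSum_sub, ← Real.dist_eq, ← edist_dist]
    refine (edist_triangle_left _ _ (signSum (fun i => b i (A.rep 0 q₀)) ε)).trans ?_
    refine (add_le_add (hroot ε q) (hroot ε q₀)).trans_eq ?_
    ring
  calc _ ≤ ∑ ε, (w ε * (2 * (ENNReal.ofReal σ * Γ))) ^ κ :=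
        Finset.sum_le_sum fun ε _ => ENNReal.rpow_le_rpow (hsup ε) hκ.le
    _ = (∑ ε, w ε ^ κ) * (2 * (ENNReal.ofReal σ * Γ)) ^ κ := by
        simp_rw [ENNReal.mul_rpow_of_nonneg _ _ hκ.le, Finset.sum_mul]
    _ ≤ _ := by
        rw [← mul_assoc (2 ^ _)]
        gcongr

end AdmissibleSequence

/-! ### Symmetrization -/

lemma rpow_lintegral_le_lintegral_rpow {α : Type*} [MeasurableSpace α] {μ : Measure α}
    [IsProbabilityMeasure μ] {κ : ℝ} (hκ : 1 ≤ κ) {f : α → ℝ≥0∞} (hf : Measurable f) :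
    (∫⁻ x, f x ∂μ) ^ κ ≤ ∫⁻ x, f x ^ κ ∂μ := by
  have h := eLpNorm'_le_eLpNorm'_of_exponent_le one_pos hκ μ hf.aestronglyMeasurable
  simp only [eLpNorm', enorm_eq_self, ENNReal.rpow_one, one_div, inv_one] at h
  rwa [ENNReal.le_rpow_inv_iff (by linarith)] at h

/-- Jensen's inequality for the supremum of a countable family. -/
lemma iSup_abs_integral_rpow_le {α J : Type*} [MeasurableSpace α] [Countable J] {μ : Measure α}
    [IsProbabilityMeasure μ] {κ : ℝ} (hκ : 1 ≤ κ) {h : J → α → ℝ} (hm : ∀ j, Measurable (h j)) :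
    (⨆ j, ENNReal.ofReal |∫ x, h j x ∂μ|) ^ κ
      ≤ ∫⁻ x, (⨆ j, ENNReal.ofReal |h j x|) ^ κ ∂μ := by
  refine le_trans (ENNReal.rpow_le_rpow (iSup_le fun j => ?_) (by linarith))
    (rpow_lintegral_le_lintegral_rpow hκ
      (Measurable.iSup fun j => (hm j).abs.ennreal_ofReal))
  rw [← Real.enorm_eq_ofReal_abs]
  refine (enorm_integral_le_lintegral_enorm _).trans (lintegral_mono fun x => ?_)
  rw [Real.enorm_eq_ofReal_abs]
  exact le_iSup (fun j => ENNReal.ofReal |h j x|) j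

section Symmetrization

variable {ι 𝒴 E J : Type*} [Fintype ι] [MeasurableSpace 𝒴] [Countable J]

/-- The increment from `q₀` to `q` of the centered empirical process of independent observations
`y i` with laws `ν i`. -/
noncomputable def centeredSum (ν : ι → Measure 𝒴) (f : ι → 𝒴 → E → ℝ) (q₀ q : E) (y : ι → 𝒴) : ℝ :=
  ∑ i, (f i (y i) q - f i (y i) q₀ - ∫ u, (f i u q - f i u q₀) ∂ν i)

/-- The pairwise differences `f i (w i).1 q - f i (w i).2 q` of a sample and its independent
copy. -/
def pairDiff (f : ι → 𝒴 → E → ℝ) (w : ι → 𝒴 × 𝒴) (i : ι) (q : E) : ℝ :=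
  f i (w i).1 q - f i (w i).2 q

lemma measurable_iSup_signSum_pairDiff {f : ι → 𝒴 → E → ℝ}
    (hf : ∀ i q, Measurable fun y => f i y q) (d : J → E) (q₀ : E) (ε : ι → Bool) :
    Measurable fun w : ι → 𝒴 × 𝒴 =>
      ⨆ j, ENNReal.ofReal |signSum (fun i => pairDiff f w i (d j) - pairDiff f w i q₀) ε| := by
  refine Measurable.iSup fun j => (Measurable.abs ?_).ennreal_ofReal
  unfold signSum
  refine Finset.measurable_sum _ fun i _ => ?_
  have h1 : ∀ q, Measurable fun w : ι → 𝒴 × 𝒴 => f i (w i).1 q := fun q =>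
    (hf i q).comp (measurable_fst.comp (measurable_pi_apply i))
  have h2 : ∀ q, Measurable fun w : ι → 𝒴 × 𝒴 => f i (w i).2 q := fun q =>
    (hf i q).comp (measurable_snd.comp (measurable_pi_apply i))
  have h : Measurable fun w : ι → 𝒴 × 𝒴 => pairDiff f w i (d j) - pairDiff f w i q₀ :=
    ((h1 _).sub (h2 _)).sub ((h1 _).sub (h2 _))
  split_ifs
  · exact h
  · exact h.neg

/-- Introduction of an independent copy of the sample. -/
lemma lintegral_centeredSum_le_pairDiff (ν : ι → Measure 𝒴) [∀ i, IsProbabilityMeasure (ν i)]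
    {κ : ℝ} (hκ : 1 ≤ κ) {f : ι → 𝒴 → E → ℝ} (hf : ∀ i q, Measurable fun y => f i y q)
    (hint : ∀ i q, Integrable (fun y => f i y q) (ν i)) (d : J → E) (q₀ : E) :
    ∫⁻ y, (⨆ j, ENNReal.ofReal |centeredSum ν f q₀ (d j) y|) ^ κ ∂Measure.pi ν
      ≤ ∫⁻ w, (⨆ j, ENNReal.ofReal
          |signSum (fun i => pairDiff f w i (d j) - pairDiff f w i q₀) fun _ => true|) ^ κ
          ∂Measure.pi fun i => (ν i).prod (ν i) := by
  set h : J → (ι → 𝒴) → (ι → 𝒴) → ℝ := fun j y y' =>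
    ∑ i, (f i (y i) (d j) - f i (y i) q₀ - (f i (y' i) (d j) - f i (y' i) q₀)) with hh
  have hfi : ∀ i q, Measurable fun y : ι → 𝒴 => f i (y i) q := fun i q =>
    (hf i q).comp (measurable_pi_apply i)
  have hm : ∀ j, Measurable fun p : (ι → 𝒴) × (ι → 𝒴) => h j p.1 p.2 := fun j => by
    refine Finset.measurable_sum _ fun i _ => ?_
    exact (((hfi i _).comp measurable_fst).sub ((hfi i _).comp measurable_fst)).sub
      (((hfi i _).comp measurable_snd).sub ((hfi i _).comp measurable_snd))
  have hcent : ∀ j y, centeredSum ν f q₀ (d j) y = ∫ y', h j y y' ∂Measure.pi ν := by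
    intro j y
    have hI : ∀ i, Integrable (fun u => f i u (d j) - f i u q₀) (ν i) := fun i =>
      (hint i _).sub (hint i _)
    have hI' : ∀ i, Integrable (fun y' : ι → 𝒴 => f i (y' i) (d j) - f i (y' i) q₀)
        (Measure.pi ν) := fun i =>
      integrable_comp_eval (X := fun _ => 𝒴) (f := fun u => f i u (d j) - f i u q₀) (hI i)
    simp only [hh, centeredSum]
    refine Eq.trans ?_ (integral_finsetSum _ fun i _ => (integrable_const _).sub (hI' i)).symm
    refine Finset.sum_congr rfl fun i _ => ?_
    refine Eq.trans ?_ (integral_sub (integrable_const _) (hI' i)).symm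
    simp only [integral_const, probReal_univ, one_smul]
    rw [integral_comp_eval (X := fun _ => 𝒴) (f := fun u => f i u (d j) - f i u q₀)
      (hI i).aestronglyMeasurable]
  have hG : Measurable fun p : (ι → 𝒴) × (ι → 𝒴) =>
      (⨆ j, ENNReal.ofReal |h j p.1 p.2|) ^ κ :=
    (Measurable.iSup fun j => (hm j).abs.ennreal_ofReal).pow_const κ
  calc _ ≤ ∫⁻ y, ∫⁻ y', (⨆ j, ENNReal.ofReal |h j y y'|) ^ κ ∂Measure.pi ν ∂Measure.pi ν := by
        refine lintegral_mono fun y => ?_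
        simp_rw [hcent]
        exact iSup_abs_integral_rpow_le hκ fun j => (hm j).comp measurable_prodMk_left
    _ = ∫⁻ p, (⨆ j, ENNReal.ofReal |h j p.1 p.2|) ^ κ ∂(Measure.pi ν).prod (Measure.pi ν) :=
        (lintegral_prod _ hG.aemeasurable).symm
    _ = _ := by
        rw [← (measurePreserving_arrowProdEquivProdArrow 𝒴 𝒴 ι ν ν).lintegral_comp hG]
        refine lintegral_congr fun w => ?_
        congr 1
        refine iSup_congr fun j => ?_
        congr 2
        simp only [hh, signSum, if_true, pairDiff]
        refine Finset.sum_congr rfl fun i _ => ?_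
        change f i (w i).1 (d j) - f i (w i).1 q₀ - (f i (w i).2 (d j) - f i (w i).2 q₀) = _
        ring

/-- The law of the pairwise differences is invariant under exchanging the two observations of
some of the pairs, so that random signs may be introduced. -/
lemma lintegral_signSum_pairDiff_eq (ν : ι → Measure 𝒴) [∀ i, IsProbabilityMeasure (ν i)]
    (κ : ℝ) {f : ι → 𝒴 → E → ℝ} (hf : ∀ i q, Measurable fun y => f i y q)
    (d : J → E) (q₀ : E) (ε : ι → Bool) :
    ∫⁻ w, (⨆ j, ENNReal.ofReal
        |signSum (fun i => pairDiff f w i (d j) - pairDiff f w i q₀) ε|) ^ κ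
        ∂(Measure.pi fun i => (ν i).prod (ν i))
      = ∫⁻ w, (⨆ j, ENNReal.ofReal
          |signSum (fun i => pairDiff f w i (d j) - pairDiff f w i q₀) fun _ => true|) ^ κ
          ∂(Measure.pi fun i => (ν i).prod (ν i)) := by
  have hmp : MeasurePreserving
      (fun (w : ι → 𝒴 × 𝒴) i => (if ε i then id else Prod.swap : 𝒴 × 𝒴 → 𝒴 × 𝒴) (w i))
      (Measure.pi fun i => (ν i).prod (ν i)) (Measure.pi fun i => (ν i).prod (ν i)) := by
    refine measurePreserving_pi _ _ fun i => ?_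
    split_ifs
    · exact MeasurePreserving.id _
    · exact Measure.measurePreserving_swap
  rw [← hmp.lintegral_comp
    ((measurable_iSup_signSum_pairDiff hf d q₀ fun _ => true).pow_const κ)]
  refine lintegral_congr fun w => ?_
  congr 1
  refine iSup_congr fun j => ?_
  congr 2
  unfold signSum pairDiff
  refine Finset.sum_congr rfl fun i _ => ?_
  rcases hε : ε i with _ | _
  · simp only [hε, Bool.false_eq_true, if_false, if_true, Prod.fst_swap, Prod.snd_swap]
    ring
  · simp [hε]

/-- The moment of the Euclidean norm of independent variables in terms of their moments. -/
lemma ofReal_sqrt_rpow_le {κ : ℝ} (hκ : 2 ≤ κ) (s t : ι → ℝ) (hs : ∀ i, 0 ≤ s i)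
    (ht : ∀ i, 0 ≤ t i) :
    ENNReal.ofReal (Real.sqrt (∑ i, (s i + t i) ^ 2)) ^ κ
      ≤ (Fintype.card ι : ℝ≥0∞) ^ (κ / 2 - 1) * (2 ^ (κ - 1) *
        ∑ i, (ENNReal.ofReal (s i) ^ κ + ENNReal.ofReal (t i) ^ κ)) := by
  have h0 : 0 ≤ ∑ i, (s i + t i) ^ 2 := Finset.sum_nonneg fun i _ => sq_nonneg _
  calc ENNReal.ofReal (Real.sqrt (∑ i, (s i + t i) ^ 2)) ^ κ
      = (∑ i, (ENNReal.ofReal (s i) + ENNReal.ofReal (t i)) ^ (2 : ℝ)) ^ (κ / 2) := by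
        have : ∑ i, (ENNReal.ofReal (s i) + ENNReal.ofReal (t i)) ^ (2 : ℝ)
            = ENNReal.ofReal (∑ i, (s i + t i) ^ 2) := by
          rw [ENNReal.ofReal_sum_of_nonneg fun i _ => sq_nonneg _]
          refine Finset.sum_congr rfl fun i _ => ?_
          rw [← ENNReal.ofReal_add (hs i) (ht i), ENNReal.rpow_two,
            ENNReal.ofReal_pow (add_nonneg (hs i) (ht i))]
        rw [this, Real.sqrt_eq_rpow, ← ENNReal.ofReal_rpow_of_nonneg h0 (by norm_num),
          ← ENNReal.rpow_mul]
        congr 1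
        ring
    _ ≤ (Fintype.card ι : ℝ≥0∞) ^ (κ / 2 - 1) *
          ∑ i, ((ENNReal.ofReal (s i) + ENNReal.ofReal (t i)) ^ (2 : ℝ)) ^ (κ / 2) :=
        ENNReal.rpow_sum_le_const_mul_sum_rpow _ _ (by linarith)
    _ ≤ _ := by
        rw [Finset.mul_sum (a := (2 : ℝ≥0∞) ^ (κ - 1))]
        gcongr with i
        rw [← ENNReal.rpow_mul, mul_div_cancel₀ κ (by norm_num : (2 : ℝ) ≠ 0)]
        exact ENNReal.rpow_add_le_mul_rpow_add_rpow _ _ (by linarith)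

/-- Moment bound for the supremum of the empirical process of independent, not necessarily
identically distributed observations, when the quadruple differences are Lipschitz with
random constants `a i` that have `κ`-th moments. -/
theorem lintegral_iSup_centeredSum_rpow_le [PseudoMetricSpace E] (A : AdmissibleSequence E)
    {Γ : ℝ≥0∞} (hΓ : Γ ≠ ∞) (hA : ∀ q, A.chainSum q ≤ Γ)
    (ν : ι → Measure 𝒴) [∀ i, IsProbabilityMeasure (ν i)] {κ : ℝ} (hκ : 2 ≤ κ)
    {f : ι → 𝒴 → E → ℝ} (hf : ∀ i q, Measurable fun y => f i y q)
    (hint : ∀ i q, Integrable (fun y => f i y q) (ν i))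
    (z : ι → 𝒴) {a : ι → 𝒴 → ℝ} (ha : ∀ i, Measurable (a i)) (ha0 : ∀ i y, 0 ≤ a i y)
    (hlip : ∀ i, ∀ᵐ y ∂ν i, ∀ p q,
      |f i y p - f i (z i) p - f i y q + f i (z i) q| ≤ a i y * dist p q)
    {M : ℝ≥0∞} (hM : ∀ i, ∫⁻ y, ENNReal.ofReal (a i y) ^ κ ∂ν i ≤ M) (d : J → E) (q₀ : E) :
    ∫⁻ y, (⨆ j, ENNReal.ofReal |centeredSum ν f q₀ (d j) y|) ^ κ ∂Measure.pi ν
      ≤ ENNReal.ofReal (chainConst κ) * (4 * Γ) ^ κ *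
        ((Fintype.card ι : ℝ≥0∞) ^ (κ / 2) * M) := by
  classical
  have hκ0 : 0 < κ := by linarith
  refine (lintegral_centeredSum_le_pairDiff ν (by linarith) hf hint d q₀).trans ?_
  set μ₂ := Measure.pi fun i => (ν i).prod (ν i)
  have hp1 : ∀ i, MeasurePreserving (fun w : ι → 𝒴 × 𝒴 => (w i).1) μ₂ (ν i) := fun i =>
    measurePreserving_fst.comp (measurePreserving_eval (fun i => (ν i).prod (ν i)) i)
  have hp2 : ∀ i, MeasurePreserving (fun w : ι → 𝒴 × 𝒴 => (w i).2) μ₂ (ν i) := fun i =>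
    measurePreserving_snd.comp (measurePreserving_eval (fun i => (ν i).prod (ν i)) i)
  set H : (ι → Bool) → (ι → 𝒴 × 𝒴) → ℝ≥0∞ := fun ε w => (⨆ j, ENNReal.ofReal
    |signSum (fun i => pairDiff f w i (d j) - pairDiff f w i q₀) ε|) ^ κ with hH
  have hHm : ∀ ε, Measurable (H ε) := fun ε =>
    (measurable_iSup_signSum_pairDiff hf d q₀ ε).pow_const κ
  -- conditionally on the pairs, the process is a Rademacher process
  have hpt : ∀ᵐ w ∂μ₂, ∑ ε, H ε w ≤ 2 ^ Fintype.card ι *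
      (ENNReal.ofReal (chainConst κ) * (2 * Γ) ^ κ * ((Fintype.card ι : ℝ≥0∞) ^ (κ / 2 - 1) *
        (2 ^ (κ - 1) * ∑ i, (ENNReal.ofReal (a i (w i).1) ^ κ
          + ENNReal.ofReal (a i (w i).2) ^ κ)))) := by
    have hw1 : ∀ᵐ w ∂μ₂, ∀ i, ∀ p q, |f i (w i).1 p - f i (z i) p - f i (w i).1 q + f i (z i) q|
        ≤ a i (w i).1 * dist p q := ae_all_iff.2 fun i =>
      (hp1 i).quasiMeasurePreserving.ae (hlip i)
    have hw2 : ∀ᵐ w ∂μ₂, ∀ i, ∀ p q, |f i (w i).2 p - f i (z i) p - f i (w i).2 q + f i (z i) q|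
        ≤ a i (w i).2 * dist p q := ae_all_iff.2 fun i =>
      (hp2 i).quasiMeasurePreserving.ae (hlip i)
    filter_upwards [hw1, hw2] with w h1 h2
    set σ := Real.sqrt (∑ i, (a i (w i).1 + a i (w i).2) ^ 2) with hσ
    have hσ2 : σ ^ 2 = ∑ i, (a i (w i).1 + a i (w i).2) ^ 2 :=
      Real.sq_sqrt (Finset.sum_nonneg fun i _ => sq_nonneg _)
    have hb : ∀ p q, ∑ i, (pairDiff f w i p - pairDiff f w i q) ^ 2 ≤ (σ * dist p q) ^ 2 := by
      intro p q
      rw [mul_pow, hσ2, Finset.sum_mul]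
      refine Finset.sum_le_sum fun i _ => ?_
      rw [← mul_pow]
      refine sq_le_sq' ?_ ?_ <;>
      · have e1 := abs_le.1 (h1 i p q)
        have e2 := abs_le.1 (h2 i p q)
        unfold pairDiff
        linarith [e1.1, e1.2, e2.1, e2.2]
    have hch := A.sum_iSup_signSum_rpow_le hκ0 hΓ hA (pairDiff f w) (Real.sqrt_nonneg _) hb q₀
    calc ∑ ε, H ε w ≤ _ := Finset.sum_le_sum fun ε _ => ENNReal.rpow_le_rpow
          (iSup_le fun j => le_iSup (fun q => ENNReal.ofReal
            |signSum (fun i => pairDiff f w i q - pairDiff f w i q₀) ε|) (d j)) hκ0.le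
      _ ≤ _ := hch
      _ = 2 ^ Fintype.card ι * (ENNReal.ofReal (chainConst κ) * (2 * Γ) ^ κ *
            ENNReal.ofReal σ ^ κ) := by
          rw [mul_left_comm 2, ENNReal.mul_rpow_of_nonneg (ENNReal.ofReal σ) _ hκ0.le]
          ring
      _ ≤ _ := by
          gcongr
          exact ofReal_sqrt_rpow_le hκ _ _ (fun i => ha0 i _) fun i => ha0 i _
  have hmom : ∫⁻ w, ∑ i, (ENNReal.ofReal (a i (w i).1) ^ κ + ENNReal.ofReal (a i (w i).2) ^ κ) ∂μ₂
      ≤ Fintype.card ι * (2 * M) := by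
    have hai : ∀ i, Measurable fun y => ENNReal.ofReal (a i y) ^ κ := fun i =>
      (ha i).ennreal_ofReal.pow_const κ
    have e1 : ∀ i, ∫⁻ w, ENNReal.ofReal (a i (w i).1) ^ κ ∂μ₂ ≤ M := fun i => by
      rw [(hp1 i).lintegral_comp (hai i)]
      exact hM i
    have e2 : ∀ i, ∫⁻ w, ENNReal.ofReal (a i (w i).2) ^ κ ∂μ₂ ≤ M := fun i => by
      rw [(hp2 i).lintegral_comp (hai i)]
      exact hM i
    have m1 : ∀ i, Measurable fun w : ι → 𝒴 × 𝒴 => ENNReal.ofReal (a i (w i).1) ^ κ := fun i =>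
      (hai i).comp (measurable_fst.comp (measurable_pi_apply i))
    have m2 : ∀ i, Measurable fun w : ι → 𝒴 × 𝒴 => ENNReal.ofReal (a i (w i).2) ^ κ := fun i =>
      (hai i).comp (measurable_snd.comp (measurable_pi_apply i))
    calc _ = ∑ i, ∫⁻ w, (ENNReal.ofReal (a i (w i).1) ^ κ + ENNReal.ofReal (a i (w i).2) ^ κ) ∂μ₂ :=
          lintegral_finsetSum _ fun i _ => (m1 i).add (m2 i)
      _ ≤ ∑ _i : ι, 2 * M := Finset.sum_le_sum fun i _ => by
          rw [lintegral_add_left (m1 i), two_mul]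
          exact add_le_add (e1 i) (e2 i)
      _ = _ := by simp
  have h2 : (2 : ℝ≥0∞) ^ Fintype.card ι ≠ 0 := by simp
  have h2' : (2 : ℝ≥0∞) ^ Fintype.card ι ≠ ∞ := by simp
  rw [← ENNReal.mul_le_mul_iff_right h2 h2']
  calc 2 ^ Fintype.card ι * ∫⁻ w, H (fun _ => true) w ∂μ₂
      = ∑ ε : ι → Bool, ∫⁻ w, H ε w ∂μ₂ := by
        rw [Finset.sum_congr rfl fun ε _ => lintegral_signSum_pairDiff_eq ν κ hf d q₀ ε]
        simp [hH, μ₂]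
    _ = ∫⁻ w, ∑ ε, H ε w ∂μ₂ := (lintegral_finsetSum _ fun ε _ => hHm ε).symm
    _ ≤ _ := lintegral_mono_ae hpt
    _ ≤ 2 ^ Fintype.card ι * (ENNReal.ofReal (chainConst κ) * (2 * Γ) ^ κ *
          ((Fintype.card ι : ℝ≥0∞) ^ (κ / 2 - 1) * (2 ^ (κ - 1) * (Fintype.card ι * (2 * M))))) := by
        have hconst : ∀ c : ℝ≥0∞, ∀ g : (ι → 𝒴 × 𝒴) → ℝ≥0∞, Measurable g →
          ∫⁻ w, c * g w ∂μ₂ = c * ∫⁻ w, g w ∂μ₂ := fun c g hg => lintegral_const_mul c hg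
        have hm : Measurable fun w : ι → 𝒴 × 𝒴 => ∑ i, (ENNReal.ofReal (a i (w i).1) ^ κ
            + ENNReal.ofReal (a i (w i).2) ^ κ) :=
          Finset.measurable_sum _ fun i _ =>
            (((ha i).ennreal_ofReal.pow_const κ).comp
              (measurable_fst.comp (measurable_pi_apply i))).add
            (((ha i).ennreal_ofReal.pow_const κ).comp
              (measurable_snd.comp (measurable_pi_apply i)))
        rw [hconst _ _ (((hm.const_mul _).const_mul _).const_mul _),
          hconst _ _ ((hm.const_mul _).const_mul _), hconst _ _ (hm.const_mul _), hconst _ _ hm]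
        gcongr
    _ = _ := by
        rcases isEmpty_or_nonempty ι with hι | hι
        · have : (0 : ℝ≥0∞) ^ (κ / 2) = 0 := ENNReal.zero_rpow_of_pos (by linarith)
          simp [this]
        congr 1
        have hc0 : (Fintype.card ι : ℝ≥0∞) ≠ 0 := by simp
        have e1 : (Fintype.card ι : ℝ≥0∞) ^ (κ / 2)
            = (Fintype.card ι : ℝ≥0∞) ^ (κ / 2 - 1) * Fintype.card ι := by
          conv_rhs => rw [← ENNReal.rpow_one (Fintype.card ι : ℝ≥0∞), ← ENNReal.rpow_mul]
          rw [one_mul, ← ENNReal.rpow_add _ _ hc0 (by simp)]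
          congr 1
          ring
        have e2 : (4 * Γ) ^ κ = (2 : ℝ≥0∞) ^ (κ - 1) * 2 * (2 * Γ) ^ κ := by
          rw [show (4 : ℝ≥0∞) * Γ = 2 * (2 * Γ) by rw [← mul_assoc]; norm_num,
            ENNReal.mul_rpow_of_nonneg _ (2 * Γ) hκ0.le]
          congr 1
          conv_rhs => rw [← ENNReal.rpow_one 2, ← ENNReal.rpow_mul]
          rw [one_mul, ← ENNReal.rpow_add _ _ (by simp) (by simp)]
          congr 1
          ring
        rw [e1, e2]
        ring

end Symmetrization

/-! ### Deviation of the empirical process -/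

namespace AdmissibleSequence

/-- The representatives of all parts of an admissible sequence with finite chaining sums form a
countable dense subset. -/
lemma exists_countable_denseRange {E : Type*} [PseudoEMetricSpace E] (A : AdmissibleSequence E)
    (hA : ∀ q, A.chainSum q ≠ ∞) : ∃ s : Set E, s.Countable ∧ Dense s := by
  have hfin : ∀ k, Finite (Quotient (A.part (k + 1))) := fun k => by
    rw [← ENat.card_lt_top]
    refine (A.card_le (k + 1) (Nat.succ_le_succ (Nat.zero_le k))).trans_lt ?_
    exact_mod_cast ENat.natCast_lt_top (2 ^ 2 ^ (k + 1))
  refine ⟨⋃ k, Set.range (Quotient.out : Quotient (A.part (k + 1)) → E),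
    Set.countable_iUnion fun k => (Set.finite_range _).countable, fun q => ?_⟩
  refine mem_closure_of_tendsto ((A.tendsto_rep (hA q)).comp (Filter.tendsto_add_atTop_nat 1))
    (Filter.Eventually.of_forall fun k => Set.mem_iUnion.2 ⟨k, ⟨_, rfl⟩⟩)

end AdmissibleSequence

section Deviation

variable {ι 𝒴 E Ω : Type*} [Fintype ι] [MeasurableSpace 𝒴] [MeasurableSpace Ω]
  [PseudoMetricSpace E]

lemma continuous_centeredSum (ν : ι → Measure 𝒴) [∀ i, IsProbabilityMeasure (ν i)]
    {f : ι → 𝒴 → E → ℝ} (hint : ∀ i q, Integrable (fun y => f i y q) (ν i))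
    (z : ι → 𝒴) {a : ι → 𝒴 → ℝ} (hai : ∀ i, Integrable (a i) (ν i))
    (hlip : ∀ i, ∀ᵐ y ∂ν i, ∀ p q,
      |f i y p - f i (z i) p - f i y q + f i (z i) q| ≤ a i y * dist p q) (q₀ : E)
    {y : ι → 𝒴} (hy : ∀ i, ∀ p q,
      |f i (y i) p - f i (z i) p - f i (y i) q + f i (z i) q| ≤ a i (y i) * dist p q) :
    Continuous fun q => centeredSum ν f q₀ q y := by
  unfold centeredSum
  refine continuous_finsetSum _ fun i _ => ?_
  refine (LipschitzWith.of_dist_le_mul (K := (a i (y i) + ∫ u, a i u ∂ν i).toNNReal)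
    fun p q => ?_).continuous
  have h1 : |∫ u, (f i u p - f i (z i) p - f i u q + f i (z i) q) ∂ν i|
      ≤ (∫ u, a i u ∂ν i) * dist p q := by
    rw [← integral_mul_const, ← Real.norm_eq_abs]
    refine norm_integral_le_of_norm_le ((hai i).mul_const _) ?_
    filter_upwards [hlip i] with u hu using hu p q
  have h2 : ∫ u, (f i u p - f i (z i) p - f i u q + f i (z i) q) ∂ν i
      = ∫ u, (f i u p - f i u q₀) ∂ν i - ∫ u, (f i u q - f i u q₀) ∂ν i
        - (f i (z i) p - f i (z i) q) := by
    have hs : ∀ p q, ∫ u, (f i u p - f i u q) ∂ν i = ∫ u, f i u p ∂ν i - ∫ u, f i u q ∂ν i :=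
      fun p q => integral_sub (hint i p) (hint i q)
    have hd : Integrable (fun u => f i u p - f i u q) (ν i) := (hint i p).sub (hint i q)
    calc _ = ∫ u, (f i u p - f i u q - (f i (z i) p - f i (z i) q)) ∂ν i := by
          congr 1
          funext u
          ring
      _ = ∫ u, (f i u p - f i u q) ∂ν i - ∫ _u, (f i (z i) p - f i (z i) q) ∂ν i :=
          integral_sub hd (integrable_const _)
      _ = _ := by
          rw [hs, hs, hs]
          simp
  rw [Real.dist_eq]
  refine le_trans ?_ (mul_le_mul_of_nonneg_right (Real.le_coe_toNNReal _) dist_nonneg)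
  have h3 := hy i p q
  have e1 := abs_le.1 h1
  have e3 := abs_le.1 h3
  rw [h2] at e1
  rw [abs_le]
  constructor <;> linarith [e1.1, e1.2, e3.1, e3.2]

lemma integrable_of_lintegral_rpow_le {ν : Measure 𝒴} [IsProbabilityMeasure ν] {κ : ℝ}
    (hκ : 1 ≤ κ) {a : 𝒴 → ℝ} (ha : Measurable a) (ha0 : ∀ y, 0 ≤ a y) {M : ℝ≥0∞} (hM' : M ≠ ∞)
    (hM : ∫⁻ y, ENNReal.ofReal (a y) ^ κ ∂ν ≤ M) : Integrable a ν := by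
  refine ⟨ha.aestronglyMeasurable, ?_⟩
  rw [hasFiniteIntegral_iff_ofReal (Filter.Eventually.of_forall ha0)]
  have h := (rpow_lintegral_le_lintegral_rpow hκ (μ := ν) ha.ennreal_ofReal).trans hM
  exact ((ENNReal.rpow_lt_top_iff_of_pos (by linarith)).1 (h.trans_lt hM'.lt_top))

/-- Markov's inequality for the supremum of the empirical process. The set `s` need not be
measurable, and the maximizing parameter may depend on `ω` in an arbitrary way. -/
theorem measure_mul_rpow_le_of_centeredSum_ge (A : AdmissibleSequence E)
    {Γ : ℝ≥0∞} (hΓ : Γ ≠ ∞) (hA : ∀ q, A.chainSum q ≤ Γ)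
    (ν : ι → Measure 𝒴) [∀ i, IsProbabilityMeasure (ν i)] {κ : ℝ} (hκ : 2 ≤ κ)
    {f : ι → 𝒴 → E → ℝ} (hf : ∀ i q, Measurable fun y => f i y q)
    (hint : ∀ i q, Integrable (fun y => f i y q) (ν i))
    (z : ι → 𝒴) {a : ι → 𝒴 → ℝ} (ha : ∀ i, Measurable (a i)) (ha0 : ∀ i y, 0 ≤ a i y)
    (hlip : ∀ i, ∀ᵐ y ∂ν i, ∀ p q,
      |f i y p - f i (z i) p - f i y q + f i (z i) q| ≤ a i y * dist p q)
    {M : ℝ≥0∞} (hM' : M ≠ ∞) (hM : ∀ i, ∫⁻ y, ENNReal.ofReal (a i y) ^ κ ∂ν i ≤ M) (q₀ : E)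
    {P : Measure Ω} {Y : Ω → ι → 𝒴} (hY : Measurable Y) (hYν : P.map Y = Measure.pi ν)
    {t : ℝ} {s : Set Ω}
    (hs : ∀ᵐ ω ∂P, ω ∈ s → ∃ q, t ≤ |centeredSum ν f q₀ q (Y ω)|) :
    P s * ENNReal.ofReal t ^ κ
      ≤ ENNReal.ofReal (chainConst κ) * (4 * Γ) ^ κ *
        ((Fintype.card ι : ℝ≥0∞) ^ (κ / 2) * M) := by
  obtain ⟨D, hDc, hD⟩ := A.exists_countable_denseRange
    fun q => ne_top_of_le_ne_top hΓ (hA q)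
  have : Countable D := hDc.to_subtype
  set G : (ι → 𝒴) → ℝ≥0∞ := fun y =>
    (⨆ j : D, ENNReal.ofReal |centeredSum ν f q₀ j y|) ^ κ with hG
  have hGm : Measurable G := by
    refine (Measurable.iSup fun j => (Measurable.abs ?_).ennreal_ofReal).pow_const κ
    unfold centeredSum
    exact Finset.measurable_sum _ fun i _ =>
      ((((hf i _).comp (measurable_pi_apply i)).sub ((hf i _).comp (measurable_pi_apply i))).sub
        measurable_const)
  have hcont : ∀ᵐ y ∂Measure.pi ν, Continuous fun q => centeredSum ν f q₀ q y := by
    have h : ∀ᵐ y ∂Measure.pi ν, ∀ i, ∀ p q,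
        |f i (y i) p - f i (z i) p - f i (y i) q + f i (z i) q| ≤ a i (y i) * dist p q :=
      ae_all_iff.2 fun i => (Measure.quasiMeasurePreserving_eval ν i).ae (hlip i)
    filter_upwards [h] with y hy
    exact continuous_centeredSum ν hint z
      (fun i => integrable_of_lintegral_rpow_le (by linarith) (ha i) (ha0 i) hM' (hM i))
      hlip q₀ hy
  rw [← hYν] at hcont
  have hsub : P s ≤ Measure.pi ν {y | ENNReal.ofReal t ^ κ ≤ G y} := by
    rw [← hYν, Measure.map_apply hY (measurableSet_le measurable_const hGm)]
    refine measure_mono_ae ?_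
    filter_upwards [hs, ae_of_ae_map hY.aemeasurable hcont] with ω h1 h2 hω
    obtain ⟨q, hq⟩ := h1 hω
    refine ENNReal.rpow_le_rpow ((ENNReal.ofReal_le_ofReal hq).trans ?_) (by linarith)
    -- the supremum over the dense set bounds the process everywhere
    have hcl : IsClosed {q | ENNReal.ofReal |centeredSum ν f q₀ q (Y ω)|
        ≤ ⨆ j : D, ENNReal.ofReal |centeredSum ν f q₀ j (Y ω)|} :=
      isClosed_le (ENNReal.continuous_ofReal.comp h2.abs) continuous_const
    exact hcl.closure_subset_iff.2
      (fun j hj => le_iSup (fun j : D => ENNReal.ofReal |centeredSum ν f q₀ j (Y ω)|) ⟨j, hj⟩)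
      (hD q)
  calc P s * ENNReal.ofReal t ^ κ
      ≤ ENNReal.ofReal t ^ κ * Measure.pi ν {y | ENNReal.ofReal t ^ κ ≤ G y} := by
        rw [mul_comm]
        gcongr
    _ ≤ ∫⁻ y, G y ∂Measure.pi ν := mul_meas_ge_le_lintegral₀ hGm.aemeasurable _
    _ ≤ _ := lintegral_iSup_centeredSum_rpow_le A hΓ hA ν hκ hf hint z ha ha0 hlip hM _ q₀

end Deviation

/-! ### Peeling -/

/-- A bound on the expectation of the positive part from a bound on dyadic shells above `T`. -/
theorem lintegral_ofReal_le_of_dyadic_tail {Ω : Type*} [MeasurableSpace Ω] {P : Measure Ω}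
    [IsProbabilityMeasure P] {L : Ω → ℝ} (hL : AEMeasurable L P) {r T p K : ℝ} (hr : 0 < r)
    (hT : 0 ≤ T) (hp : 1 < p) (hK : 0 ≤ K)
    (htail : ∀ δ : ℝ, 0 < δ → T ≤ δ →
      P {ω | δ ≤ L ω ∧ L ω < 2 * δ} ≤ ENNReal.ofReal (K * (r / δ) ^ p)) :
    ∫⁻ ω, ENNReal.ofReal (L ω) ∂P
      ≤ ENNReal.ofReal ((1 + 2 * K * (1 - (2⁻¹ : ℝ) ^ (p - 1))⁻¹) * r + T) := by
  set δ₀ := max r T with hδ₀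
  have hδ₀pos : 0 < δ₀ := lt_max_of_lt_left hr
  set δ : ℕ → ℝ := fun j => 2 ^ j * δ₀ with hδ
  have hδpos : ∀ j, 0 < δ j := fun j => by positivity
  have hδge : ∀ j, δ₀ ≤ δ j := fun j =>
    le_mul_of_one_le_left hδ₀pos.le (one_le_pow₀ (by norm_num))
  set S : ℕ → Set Ω := fun j => {ω | δ j ≤ L ω ∧ L ω < 2 * δ j} with hS
  have hSm : ∀ j, NullMeasurableSet (S j) P := fun j =>
    (nullMeasurableSet_le aemeasurable_const hL).inter
      (nullMeasurableSet_lt hL aemeasurable_const)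
  set q : ℝ := (2⁻¹ : ℝ) ^ (p - 1) with hq
  have hq0 : 0 ≤ q := by positivity
  have hq1 : q < 1 := Real.rpow_lt_one (by norm_num) (by norm_num) (by linarith)
  have hpt : ∀ ω, ENNReal.ofReal (L ω) ≤ ENNReal.ofReal δ₀
      + ∑' j, (S j).indicator (fun _ => ENNReal.ofReal (2 * δ j)) ω := by
    intro ω
    rcases le_or_gt (L ω) δ₀ with h | h
    · exact (ENNReal.ofReal_le_ofReal h).trans le_self_add
    · obtain ⟨j, hj1, hj2⟩ := exists_nat_pow_near (x := L ω / δ₀) (y := (2 : ℝ))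
        ((one_le_div hδ₀pos).2 h.le) (by norm_num)
      rw [le_div_iff₀ hδ₀pos] at hj1
      rw [div_lt_iff₀ hδ₀pos, pow_succ, mul_right_comm] at hj2
      have hmem : ω ∈ S j := ⟨hj1, by rw [mul_comm]; exact hj2⟩
      refine le_trans ?_ ((ENNReal.le_tsum (f := fun j =>
        (S j).indicator (fun _ => ENNReal.ofReal (2 * δ j)) ω) j).trans le_add_self)
      simp only [Set.indicator_of_mem hmem]
      exact ENNReal.ofReal_le_ofReal hmem.2.le
  have hshell : ∀ j, ENNReal.ofReal (2 * δ j) * P (S j) ≤ ENNReal.ofReal (2 * K * r * q ^ j) := by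
    intro j
    calc ENNReal.ofReal (2 * δ j) * P (S j)
        ≤ ENNReal.ofReal (2 * δ j) * ENNReal.ofReal (K * (r / δ j) ^ p) := by
          gcongr
          exact htail _ (hδpos j) ((le_max_right r T).trans (hδge j))
      _ = ENNReal.ofReal (2 * K * r * (r / δ j) ^ (p - 1)) := by
          rw [← ENNReal.ofReal_mul (by have := hδpos j; positivity)]
          congr 1
          rw [Real.rpow_sub_one (by have := hδpos j; positivity)]
          have := hδpos j
          field_simp
      _ ≤ _ := by
          refine ENNReal.ofReal_le_ofReal ?_
          have h1 : r / δ j ≤ 2⁻¹ ^ j := by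
            rw [div_le_iff₀ (hδpos j), hδ, inv_pow, ← mul_assoc,
              inv_mul_cancel₀ (by positivity), one_mul]
            exact le_max_left r T
          have h2 : (r / δ j) ^ (p - 1) ≤ q ^ j := by
            calc (r / δ j) ^ (p - 1) ≤ ((2⁻¹ : ℝ) ^ j) ^ (p - 1) :=
                  Real.rpow_le_rpow (by have := hδpos j; positivity) h1 (by linarith)
              _ = q ^ j := by
                  rw [hq, ← Real.rpow_natCast, ← Real.rpow_natCast, ← Real.rpow_mul (by norm_num),
                    ← Real.rpow_mul (by norm_num), mul_comm]
          gcongr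
  calc ∫⁻ ω, ENNReal.ofReal (L ω) ∂P
      ≤ ∫⁻ ω, (ENNReal.ofReal δ₀
        + ∑' j, (S j).indicator (fun _ => ENNReal.ofReal (2 * δ j)) ω) ∂P := lintegral_mono hpt
    _ = ENNReal.ofReal δ₀ + ∑' j, ENNReal.ofReal (2 * δ j) * P (S j) := by
        rw [lintegral_add_left measurable_const, lintegral_tsum fun j =>
          (aemeasurable_const.indicator₀ (hSm j))]
        simp [lintegral_indicator_const₀ (hSm _)]
    _ ≤ ENNReal.ofReal δ₀ + ∑' j, ENNReal.ofReal (2 * K * r * q ^ j) := by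
        gcongr with j
        exact hshell j
    _ = ENNReal.ofReal δ₀ + ENNReal.ofReal (2 * K * r * (1 - q)⁻¹) := by
        rw [← ENNReal.ofReal_tsum_of_nonneg (fun j => by positivity)
          ((summable_geometric_of_lt_one hq0 hq1).mul_left _), tsum_mul_left,
          tsum_geometric_of_lt_one hq0 hq1]
    _ ≤ _ := by
        have h1 : 0 ≤ (1 - q)⁻¹ := inv_nonneg.2 (by linarith)
        rw [← ENNReal.ofReal_add hδ₀pos.le (by positivity)]
        refine ENNReal.ofReal_le_ofReal ?_
        have : δ₀ ≤ r + T := max_le (by linarith) (by linarith)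
        linarith

/-! ### The M-estimator -/

section Quadruple

variable {𝒳 𝒴 𝒬 Θ : Type*} [PseudoMetricSpace Θ] (c : 𝒴 → 𝒬 → ℝ) (g : 𝒳 → Θ → 𝒬)

lemma quadruple_le_quadConst {t : 𝒳} {y z : 𝒴} (h : quadConst c g t y z ≠ ∞) (θ θ' : Θ) :
    quadruple c g t y z θ θ' ≤ (quadConst c g t y z).toReal * dist θ θ' := by
  rcases eq_or_ne θ θ' with rfl | hne
  · simp [quadruple]
  have h1 : ENNReal.ofReal (quadruple c g t y z θ θ') / ENNReal.ofReal (dist θ θ')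
      ≤ quadConst c g t y z := le_iSup₂_of_le θ θ' (le_iSup_of_le hne le_rfl)
  rw [ENNReal.div_le_iff_le_mul (Or.inr h) (Or.inl ENNReal.ofReal_ne_top),
    ← ENNReal.ofReal_toReal h, ← ENNReal.ofReal_mul ENNReal.toReal_nonneg] at h1
  exact (ENNReal.ofReal_le_ofReal_iff (by positivity)).1 h1

lemma abs_quadruple_le_quadConst {t : 𝒳} {y z : 𝒴} (h : quadConst c g t y z ≠ ∞) (θ θ' : Θ) :
    |quadruple c g t y z θ θ'| ≤ (quadConst c g t y z).toReal * dist θ θ' := by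
  refine abs_le.2 ⟨?_, quadruple_le_quadConst c g h θ θ'⟩
  have h1 := quadruple_le_quadConst c g h θ' θ
  rw [dist_comm] at h1
  unfold quadruple at h1 ⊢
  linarith

/-- An almost everywhere measurable quadruple constant with finite moment can be replaced by a
measurable real-valued Lipschitz constant. -/
lemma exists_measurable_lipschitz_const [MeasurableSpace 𝒴] {κ : ℝ} (hκ : 0 < κ) {t : 𝒳} {z : 𝒴}
    {ν : Measure 𝒴} (hm : AEMeasurable (fun u => quadConst c g t u z) ν) {M : ℝ≥0∞} (hM' : M ≠ ∞)
    (hM : ∫⁻ u, quadConst c g t u z ^ κ ∂ν ≤ M) :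
    ∃ a : 𝒴 → ℝ, Measurable a ∧ (∀ u, 0 ≤ a u) ∧ ∫⁻ u, ENNReal.ofReal (a u) ^ κ ∂ν ≤ M ∧
      ∀ᵐ u ∂ν, ∀ θ θ', |quadruple c g t u z θ θ'| ≤ a u * dist θ θ' := by
  have hfin : ∀ᵐ u ∂ν, quadConst c g t u z < ∞ := by
    filter_upwards [ae_lt_top' (hm.pow_const κ) (ne_top_of_le_ne_top hM' hM)] with u hu
    exact (ENNReal.rpow_lt_top_iff_of_pos hκ).1 hu
  refine ⟨fun u => (hm.mk _ u).toReal, hm.measurable_mk.ennreal_toReal,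
    fun u => ENNReal.toReal_nonneg, ?_, ?_⟩
  · refine (lintegral_mono_ae ?_).trans hM
    filter_upwards [hm.ae_eq_mk] with u hu
    rw [hu]
    gcongr
    exact ENNReal.ofReal_toReal_le
  · filter_upwards [hm.ae_eq_mk, hfin] with u hu hu' θ θ'
    have := abs_quadruple_le_quadConst c g hu'.ne θ θ'
    rwa [hu] at this

end Quadruple

/-- An infimum over admissible sequences that is below `Γ` is almost attained. -/
lemma exists_chainSum_le_of_gammaTwo_lt {E : Type*} [PseudoEMetricSpace E] {Γ : ℝ≥0∞}
    (h : gammaTwo E < Γ) : ∃ A : AdmissibleSequence E, ∀ q, A.chainSum q ≤ Γ := by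
  obtain ⟨A, hA⟩ := iInf_lt_iff.1 h
  exact ⟨A, fun q => (le_iSup (fun q => A.chainSum q) q).trans hA.le⟩

/-- Probability that the averaged loss of the estimator lies in a dyadic shell. -/
theorem measure_averageLoss_shell_le {𝒳 𝒴 𝒬 Θ Ω : Type*} [MeasurableSpace 𝒴]
    [PseudoMetricSpace Θ] [MeasurableSpace Ω] {P : Measure Ω} [IsProbabilityMeasure P]
    {c : 𝒴 → 𝒬 → ℝ} {l : 𝒬 → 𝒬 → ℝ} {g : 𝒳 → Θ → 𝒬} (hc : ∀ q, Measurable fun y => c y q)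
    {θstar : Θ} {n : ℕ} (hn : 0 < n) {x : Fin n → 𝒳} {y : Fin n → Ω → 𝒴}
    (hy : ∀ i, Measurable (y i)) (hindep : iIndepFun y P)
    (hint : ∀ i q, Integrable (fun u => c u q) (P.map (y i)))
    {θhat : Ω → Θ}
    (hmin : ∀ᵐ ω ∂P, empiricalCost c g x (fun i => y i ω) (θhat ω)
      ≤ empiricalCost c g x (fun i => y i ω) θstar)
    {V : ℝ} (hV : 0 < V) (hself : averageLoss l g x θstar θstar ≤ 0)
    (hVar : ∀ i θ, V⁻¹ * l (g (x i) θstar) (g (x i) θ)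
      ≤ ∫ u, (c u (g (x i) θ) - c u (g (x i) θstar)) ∂P.map (y i))
    {κ : ℝ} (hκ : 2 ≤ κ) {z : Fin n → 𝒴} {M : ℝ≥0∞} (hM' : M ≠ ∞)
    (hMm : ∀ i, AEMeasurable (fun u => quadConst c g (x i) u (z i)) (P.map (y i)))
    (hM : ∀ i, ∫⁻ u, quadConst c g (x i) u (z i) ^ κ ∂P.map (y i) ≤ M)
    {δ : ℝ} (hδ : 0 < δ) {Γ : ℝ≥0∞} (hΓ : Γ ≠ ∞)
    (hEnt : gammaTwo (lossBall l g x θstar (2 * δ)) < Γ) :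
    P {ω | δ ≤ averageLoss l g x θstar (θhat ω) ∧ averageLoss l g x θstar (θhat ω) < 2 * δ}
        * ENNReal.ofReal (n * δ / V) ^ κ
      ≤ ENNReal.ofReal (chainConst κ) * (4 * Γ) ^ κ * ((n : ℝ≥0∞) ^ (κ / 2) * M) := by
  have hκ0 : 0 < κ := by linarith
  obtain ⟨A, hA⟩ := exists_chainSum_le_of_gammaTwo_lt hEnt
  have hprob : ∀ i, IsProbabilityMeasure (P.map (y i)) := fun i =>
    Measure.isProbabilityMeasure_map (hy i).aemeasurable
  have hpi := (iIndepFun_iff_map_fun_eq_pi_map fun i => (hy i).aemeasurable).1 hindep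
  choose a ha ha0 haM hlip using fun i =>
    exists_measurable_lipschitz_const c g hκ0 (hMm i) hM' (hM i)
  let E := lossBall l g x θstar (2 * δ)
  have hstar : θstar ∈ E := hself.trans (by positivity)
  have hn' : (0 : ℝ) < n := by exact_mod_cast hn
  have key := measure_mul_rpow_le_of_centeredSum_ge (P := P) A hΓ hA (fun i => P.map (y i)) hκ
    (f := fun i u (θ : E) => c u (g (x i) θ)) (fun i θ => hc _) (fun i θ => hint i _) z ha ha0
    (fun i => by
      filter_upwards [hlip i] with u hu θ θ' using hu θ θ')
    hM' haM ⟨θstar, hstar⟩ (measurable_pi_lambda _ hy) hpi (t := n * δ / V)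
    (s := {ω | δ ≤ averageLoss l g x θstar (θhat ω)
      ∧ averageLoss l g x θstar (θhat ω) < 2 * δ}) (by
      filter_upwards [hmin] with ω hω hs
      refine ⟨⟨θhat ω, hs.2.le⟩, ?_⟩
      -- the variance inequality, summed over the sample
      have h1 : V⁻¹ * ∑ i, l (g (x i) θstar) (g (x i) (θhat ω))
          ≤ ∑ i, ∫ u, (c u (g (x i) (θhat ω)) - c u (g (x i) θstar)) ∂P.map (y i) := by
        rw [Finset.mul_sum]
        exact Finset.sum_le_sum fun i _ => hVar i _
      have h2 : ∑ i, c (y i ω) (g (x i) (θhat ω)) ≤ ∑ i, c (y i ω) (g (x i) θstar) :=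
        le_of_mul_le_mul_left hω (by positivity)
      have h3 : n * δ ≤ ∑ i, l (g (x i) θstar) (g (x i) (θhat ω)) := by
        have := hs.1
        rw [averageLoss, one_div, inv_mul_eq_div, le_div_iff₀ hn'] at this
        linarith
      have h4 : n * δ / V ≤ V⁻¹ * ∑ i, l (g (x i) θstar) (g (x i) (θhat ω)) := by
        rw [inv_mul_eq_div]
        gcongr
      refine le_trans ?_ (neg_le_abs _)
      simp only [centeredSum, Finset.sum_sub_distrib]
      linarith)
  simpa using key

theorem mainTheorem1 (κ ξ : ℝ) (hκ : 2 ≤ κ) (hξ0 : 0 < ξ) (hξ1 : ξ < 1)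
    (hκξ : 1 < κ * (1 - ξ)) :
    ∃ C₀ : ℝ, 0 < C₀ ∧
      ∀ {𝒳 𝒴 𝒬 Θ Ω : Type*} [MeasurableSpace 𝒴] [PseudoMetricSpace Θ] [MeasurableSpace Ω]
        (P : Measure Ω) [IsProbabilityMeasure P]
        -- cost, loss, link function
        (c : 𝒴 → 𝒬 → ℝ) (l : 𝒬 → 𝒬 → ℝ) (g : 𝒳 → Θ → 𝒬)
        (_hc : ∀ q, Measurable fun y => c y q)
        -- the variables `Y_t`, with finite expected cost, and the regression function
        (Y : 𝒳 → Ω → 𝒴) (_hY : ∀ t, Measurable (Y t))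
        (_hYc : ∀ t q, Integrable (fun ω => c (Y t ω) q) P)
        (m : 𝒳 → 𝒬)
        (_hm : ∀ t q, ∫ ω, c (Y t ω) (m t) ∂P ≤ ∫ ω, c (Y t ω) q ∂P)
        -- the model and the observations
        (θstar : Θ) (_hmodel : ∀ t, g t θstar = m t)
        (n : ℕ) (_hn : 0 < n) (x : Fin n → 𝒳) (y : Fin n → Ω → 𝒴)
        (_hy : ∀ i, Measurable (y i)) (_hindep : iIndepFun y P)
        (_hdist : ∀ i, IdentDistrib (y i) (Y (x i)) P P)
        -- the M-estimator
        (θhat : Ω → Θ)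
        (_hmin : ∀ᵐ ω ∂P, ∀ θ : Θ,
          empiricalCost c g x (fun i => y i ω) (θhat ω)
            ≤ empiricalCost c g x (fun i => y i ω) θ)
        (_hmeas : AEMeasurable
          (fun ω => (1 / (n : ℝ)) * ∑ i, l (m (x i)) (g (x i) (θhat ω))) P)
        -- variance inequality
        (CVlo : ℝ) (_hVlo1 : 1 ≤ CVlo)
        (_hVar : ∀ t q, CVlo⁻¹ * l (m t) q ≤ ∫ ω, (c (Y t ω) q - c (Y t ω) (m t)) ∂P)
        -- entropy bound
        (T CEnt : ℝ) (_hT : 0 ≤ T) (_hEnt1 : 1 ≤ CEnt)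
        (_hEnt : ∀ δ : ℝ, T ≤ δ → ∀ θ₀ : Θ,
          gammaTwo (lossBall l g x θ₀ δ) ≤ ENNReal.ofReal (CEnt * δ ^ ξ))
        -- moment bound, with reference points `z t` in the data space
        (z : 𝒳 → 𝒴) (CMom : ℝ) (_hMom1 : 1 ≤ CMom)
        (_hMomMeas : ∀ t, AEMeasurable (fun u => quadConst c g t u (z t)) (P.map (Y t)))
        (_hMom : ∀ t, (∫⁻ ω, quadConst c g t (Y t ω) (z t) ^ κ ∂P) ^ (1 / κ)
          ≤ ENNReal.ofReal CMom),
        (∫⁻ ω, ENNReal.ofReal ((1 / (n : ℝ)) * ∑ i, l (m (x i)) (g (x i) (θhat ω))) ∂P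
          ≤ ENNReal.ofReal
              (C₀ * (CVlo * CEnt * CMom) ^ (1 / (1 - ξ)) * (n : ℝ) ^ (-(1 / (2 * (1 - ξ))))
                + CVlo * T)) ∧
        (∫ ω, (1 / (n : ℝ)) * ∑ i, l (m (x i)) (g (x i) (θhat ω)) ∂P
          ≤ C₀ * (CVlo * CEnt * CMom) ^ (1 / (1 - ξ)) * (n : ℝ) ^ (-(1 / (2 * (1 - ξ))))
                + CVlo * T) := by
  have hκ0 : 0 < κ := by linarith
  have h1ξ : 0 < 1 - ξ := by linarith
  set K : ℝ := chainConst κ * (8 * 2 ^ ξ) ^ κ with hKdef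
  have hK : 0 < K := mul_pos (chainConst_pos hκ0) (by positivity)
  have hq1 : (2⁻¹ : ℝ) ^ (κ * (1 - ξ) - 1) < 1 :=
    Real.rpow_lt_one (by norm_num) (by norm_num) (by linarith)
  have hq2 : 0 < (1 - (2⁻¹ : ℝ) ^ (κ * (1 - ξ) - 1))⁻¹ := inv_pos.2 (by linarith)
  refine ⟨1 + 2 * K * (1 - (2⁻¹ : ℝ) ^ (κ * (1 - ξ) - 1))⁻¹, by positivity, ?_⟩
  intro 𝒳 𝒴 𝒬 Θ Ω _ _ _ P _ c l g hc Y hY hYc m _ θstar hmodel n hn x y hy hindep hdist θhat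
    hmin hmeas V hV1 hVar T CEnt hT hEnt1 hEnt z CMom hMom1 hMomMeas hMom
  have hV0 : 0 < V := by linarith
  have hE0 : 0 < CEnt := by linarith
  have hM0 : 0 < CMom := by linarith
  have hn' : (0 : ℝ) < n := by exact_mod_cast hn
  -- everything is expressed through the laws of the observations
  have hlaw : ∀ i, P.map (y i) = P.map (Y (x i)) := fun i => (hdist i).map_eq
  have hint : ∀ i q, Integrable (fun u => c u q) (P.map (y i)) := fun i q => by
    rw [hlaw, integrable_map_measure (hc q).aestronglyMeasurable (hY _).aemeasurable]
    exact hYc _ q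
  have hVar' : ∀ i θ, V⁻¹ * l (g (x i) θstar) (g (x i) θ)
      ≤ ∫ u, (c u (g (x i) θ) - c u (g (x i) θstar)) ∂P.map (y i) := fun i θ => by
    have hcm : Measurable fun u => c u (g (x i) θ) - c u (g (x i) θstar) := (hc _).sub (hc _)
    rw [hlaw, integral_map (hY _).aemeasurable hcm.aestronglyMeasurable, hmodel]
    exact hVar _ _
  have hself : averageLoss l g x θstar θstar ≤ 0 := by
    refine mul_nonpos_of_nonneg_of_nonpos (by positivity) (Finset.sum_nonpos fun i _ => ?_)
    have h := hVar' i θstar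
    simp only [sub_self, integral_zero] at h
    exact nonpos_of_mul_nonpos_right h (inv_pos.2 hV0)
  have hMm : ∀ i, AEMeasurable (fun u => quadConst c g (x i) u (z (x i))) (P.map (y i)) :=
    fun i => by
      rw [hlaw]
      exact hMomMeas _
  have hM : ∀ i, ∫⁻ u, quadConst c g (x i) u (z (x i)) ^ κ ∂P.map (y i)
      ≤ ENNReal.ofReal CMom ^ κ := fun i => by
    rw [hlaw, lintegral_map' ((hMomMeas _).pow_const κ) (hY _).aemeasurable]
    have h := hMom (x i)
    rwa [one_div, ENNReal.rpow_inv_le_iff hκ0] at h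
  -- the rate: `r ^ (1 - ξ)` is the standardized size of the empirical process
  set r : ℝ := (V * CEnt * CMom) ^ (1 / (1 - ξ)) * (n : ℝ) ^ (-(1 / (2 * (1 - ξ)))) with hr
  have hr0 : 0 < r := by positivity
  have hrpow : r ^ (1 - ξ) = V * CEnt * CMom * (n : ℝ) ^ (-(1 / 2) : ℝ) := by
    rw [hr, Real.mul_rpow (by positivity) (by positivity), ← Real.rpow_mul (by positivity),
      ← Real.rpow_mul hn'.le]
    have e1 : 1 / (1 - ξ) * (1 - ξ) = 1 := by field_simp
    have e2 : -(1 / (2 * (1 - ξ))) * (1 - ξ) = -(1 / 2) := by field_simp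
    rw [e1, e2, Real.rpow_one]
  set L : Ω → ℝ := fun ω => (1 / (n : ℝ)) * ∑ i, l (m (x i)) (g (x i) (θhat ω)) with hL
  have hLavg : ∀ ω, averageLoss l g x θstar (θhat ω) = L ω := fun ω => by
    simp only [averageLoss, hL, hmodel]
  have htail : ∀ δ : ℝ, 0 < δ → T ≤ δ →
      P {ω | δ ≤ L ω ∧ L ω < 2 * δ} ≤ ENNReal.ofReal (K * (r / δ) ^ (κ * (1 - ξ))) := by
    intro δ hδ hTδ
    -- the factor `2` makes the bound strict, so that some admissible sequence attains it
    have hγ : gammaTwo (lossBall l g x θstar (2 * δ))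
        < ENNReal.ofReal (2 * (CEnt * (2 * δ) ^ ξ)) := by
      refine (hEnt (2 * δ) (by linarith) θstar).trans_lt ?_
      have h0 : 0 < CEnt * (2 * δ) ^ ξ := by positivity
      exact (ENNReal.ofReal_lt_ofReal_iff (by positivity)).2 (by linarith)
    have h := measure_averageLoss_shell_le (z := fun i => z (x i)) hc hn hy hindep hint
      (hmin.mono fun ω h => h θstar) hV0 hself hVar' hκ
      (ENNReal.rpow_ne_top_of_nonneg hκ0.le ENNReal.ofReal_ne_top) hMm hM hδ
      ENNReal.ofReal_ne_top hγ
    simp only [hLavg] at h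
    have ht0 : 0 < n * δ / V := by positivity
    have hreal : chainConst κ * (4 * (2 * (CEnt * (2 * δ) ^ ξ))) ^ κ
          * ((n : ℝ) ^ (κ / 2) * CMom ^ κ)
        = K * (r / δ) ^ (κ * (1 - ξ)) * (n * δ / V) ^ κ := by
      have hrate : (r / δ) ^ (κ * (1 - ξ))
          = (V * CEnt * CMom * (n : ℝ) ^ (-(1 / 2) : ℝ) / δ ^ (1 - ξ)) ^ κ := by
        rw [mul_comm κ, Real.rpow_mul (by positivity), Real.div_rpow hr0.le hδ.le, hrpow]
      have hhalf : (n : ℝ) ^ (κ / 2) = ((n : ℝ) ^ (1 / 2 : ℝ)) ^ κ := by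
        rw [← Real.rpow_mul hn'.le]
        congr 1
        ring
      rw [hrate, hhalf, hKdef, mul_assoc, mul_assoc, mul_assoc,
        ← Real.mul_rpow (by positivity) (by positivity),
        ← Real.mul_rpow (by positivity) (by positivity),
        ← Real.mul_rpow (by positivity) (by positivity),
        ← Real.mul_rpow (by positivity) (by positivity)]
      congr 2
      have hδ1 : δ = δ ^ (1 - ξ) * δ ^ ξ := by
        rw [← Real.rpow_add hδ]
        simp
      have hd0 : 0 < δ ^ (1 - ξ) := by positivity
      have hnn : (n : ℝ) ^ (-(1 / 2) : ℝ) * n = (n : ℝ) ^ (1 / 2 : ℝ) := by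
        nth_rw 2 [← Real.rpow_one (n : ℝ)]
        rw [← Real.rpow_add hn']
        norm_num
      have hdd : δ / δ ^ (1 - ξ) = δ ^ ξ := by
        rw [div_eq_iff hd0.ne', mul_comm]
        exact hδ1
      calc 4 * (2 * (CEnt * (2 * δ) ^ ξ)) * ((n : ℝ) ^ (1 / 2 : ℝ) * CMom)
          = 8 * 2 ^ ξ * (CEnt * CMom * ((n : ℝ) ^ (-(1 / 2) : ℝ) * n) * (δ / δ ^ (1 - ξ))) := by
            rw [hnn, hdd, Real.mul_rpow (by norm_num) hδ.le]
            ring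
        _ = _ := by
            field_simp
    have hRHS : ENNReal.ofReal (chainConst κ)
          * (4 * ENNReal.ofReal (2 * (CEnt * (2 * δ) ^ ξ))) ^ κ
          * ((n : ℝ≥0∞) ^ (κ / 2) * ENNReal.ofReal CMom ^ κ)
        = ENNReal.ofReal (K * (r / δ) ^ (κ * (1 - ξ))) * ENNReal.ofReal (n * δ / V) ^ κ := by
      rw [ENNReal.ofReal_rpow_of_nonneg ht0.le hκ0.le, ← ENNReal.ofReal_mul (by positivity),
        ← hreal, ENNReal.ofReal_mul (mul_nonneg (chainConst_pos hκ0).le (by positivity)),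
        ENNReal.ofReal_mul (chainConst_pos hκ0).le,
        ENNReal.ofReal_mul (by positivity : (0 : ℝ) ≤ (n : ℝ) ^ (κ / 2)),
        ← ENNReal.ofReal_rpow_of_nonneg (by positivity) hκ0.le,
        ← ENNReal.ofReal_rpow_of_nonneg hn'.le (by positivity),
        ← ENNReal.ofReal_rpow_of_nonneg hM0.le hκ0.le,
        ENNReal.ofReal_mul (by norm_num : (0 : ℝ) ≤ 4), ENNReal.ofReal_natCast,
        ENNReal.ofReal_ofNat]
    rw [hRHS] at h
    have hpos : ENNReal.ofReal (n * δ / V) ^ κ ≠ 0 :=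
      (ENNReal.rpow_pos (ENNReal.ofReal_pos.2 ht0) ENNReal.ofReal_ne_top).ne'
    exact (ENNReal.mul_le_mul_iff_left hpos
      (ENNReal.rpow_ne_top_of_nonneg hκ0.le ENNReal.ofReal_ne_top)).1 h
  have hmain : ∫⁻ ω, ENNReal.ofReal (L ω) ∂P ≤ ENNReal.ofReal
      ((1 + 2 * K * (1 - (2⁻¹ : ℝ) ^ (κ * (1 - ξ) - 1))⁻¹) * (V * CEnt * CMom) ^ (1 / (1 - ξ))
        * (n : ℝ) ^ (-(1 / (2 * (1 - ξ)))) + V * T) := by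
    refine (lintegral_ofReal_le_of_dyadic_tail hmeas hr0 hT hκξ hK.le htail).trans
      (ENNReal.ofReal_le_ofReal ?_)
    rw [mul_assoc _ ((V * CEnt * CMom) ^ (1 / (1 - ξ))), ← hr]
    have : T ≤ V * T := le_mul_of_one_le_left hT hV1
    linarith
  refine ⟨hmain, ?_⟩
  have hRHS0 : 0 ≤ (1 + 2 * K * (1 - (2⁻¹ : ℝ) ^ (κ * (1 - ξ) - 1))⁻¹)
      * (V * CEnt * CMom) ^ (1 / (1 - ξ)) * (n : ℝ) ^ (-(1 / (2 * (1 - ξ)))) + V * T := by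
    positivity
  by_cases hLi : Integrable L P
  · rw [integral_eq_lintegral_pos_part_sub_lintegral_neg_part hLi]
    exact (sub_le_self _ ENNReal.toReal_nonneg).trans
      (ENNReal.toReal_le_of_le_ofReal hRHS0 hmain)
  · -- the positive part is integrable, so here the expectation is `-∞` and the integral is `0`
    rw [integral_undef hLi]
    exact hRHS0
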